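/- Consider a downlink with $M \ge 2$ transmit antennas and $M$ single-antenna users. The channel vectors $\mathbf h_1,\dots,\mathbf h_M \in \mathbb C^M$ have i.i.d. circularly symmetric complex Gaussian entries of mean zero and unit variance, and the receiver noise has unit variance. For a fixed integer $B \ge 0$, user $i$ has a codebook of $2^B$ unit vectors $\mathbf w_{i,1},\dots,\mathbf w_{i,2^B}$; all codebook vectors of all users are independent, isotropically distributed on the unit sphere of $\mathbb C^M$, and independent of the channels. User $i$ feeds back an index $F_i \in \arg\max_k |\mathbf h_i^\dagger \mathbf w_{i,k}|$ ($B$ bits), and $\hat{\mathbf h}_i = \mathbf w_{i,F_i}$. The transmitter uses as beamforming vectors $\mathbf v_1,\dots,\mathbf v_M$ the normalized columns of $\hat{\mathbf H}^{-1}$, where $\hat{\mathbf H} = [\hat{\mathbf h}_1 \cdots \hat{\mathbf h}_M]^\dagger$ (which is invertible almost surely), with power $P/M$ for each user. For $P>0$ put $$\mathrm{SINR}_i = \frac{\frac PM |\mathbf h_i^\dagger \mathbf v_i|^2}{1+\sum_{j\ne i}\frac PM |\mathbf h_i^\dagger \mathbf v_j|^2},\qquad R_i(P) = E[\log_2(1+\mathrm{SINR}_i)],\qquad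 R_{FB}(P) = \sum_{i=1}^M R_i(P),$$ where the expectation is over the channels and the codebooks. Then these expectations are finite, and the throughput $R_{FB}(P)$ is bounded in $P>0$, so that the system is interference-limited as the SNR $P\to\infty$. Explicitly, if $M \ge 3$, then for all $P>0$ $$R_{FB}(P) \le M\left(1 + \frac{B+\log_2 e}{M-1} + \log_2 e + \log_2(M-2)\right),$$ and the same bound holds for $M\,R_i(P)$ for each user $i$. If $M = 2$, both are bounded by $M\left(1+\frac{B+\log_2 e}{M-1}\right)$, for all $P>0$. -/

import Mathlib

open MeasureTheory ProbabilityTheory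

noncomputable section

namespace FiniteRateFeedback

/-- The space `ℂ^M` of column vectors with the Euclidean norm.  For `x y : CVec M`,
`inner ℂ x y = ∑ m, conj (x m) * y m` is the scalar `x† y`. -/
abbrev CVec (M : ℕ) : Type := EuclideanSpace ℂ (Fin M)

/-- The circularly symmetric complex Gaussian law of mean zero and unit variance: real and
imaginary parts are independent real Gaussians with variance `1/2`. -/
def complexGaussian : Measure ℂ :=
  ((gaussianReal 0 (1 / 2)).prod (gaussianReal 0 (1 / 2))).map
    (fun p : ℝ × ℝ => (p.1 : ℂ) + (p.2 : ℂ) * Complex.I)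

/-- `ν` is the isotropic distribution on the unit sphere of `ℂ^M`: a probability measure carried
by the unit sphere and invariant under every unitary transformation. -/
structure IsIsotropicOnSphere {M : ℕ} (ν : Measure (CVec M)) : Prop where
  prob : IsProbabilityMeasure ν
  norm_eq_one : ∀ᵐ x ∂ν, ‖x‖ = 1
  invariant : ∀ U : CVec M ≃ₗᵢ[ℂ] CVec M, ν.map U = ν

/-- The random model with `M` antennas, `M` users and `B` feedback bits per user.
`h i` is the channel of user `i`, and `w i k`, `k < 2 ^ B`, are the vectors of the random
quantization codebook of user `i`.  `F i` is the index fed back by user `i`. -/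
structure IsModel {M B : ℕ} {Ω : Type*} [MeasurableSpace Ω] (μ : Measure Ω)
    (h : Fin M → Ω → CVec M) (w : Fin M → Fin (2 ^ B) → Ω → CVec M)
    (F : Fin M → Ω → Fin (2 ^ B)) : Prop where
  /-- Rayleigh fading: every channel entry is a unit variance complex Gaussian ... -/
  channel_law : ∀ i m, HasLaw (fun ω => h i ω m) complexGaussian μ
  /-- ... and all the channel entries, of all the users, are independent. -/
  channel_indep : iIndepFun (fun (p : Fin M × Fin M) (ω : Ω) => h p.1 ω p.2) μ
  /-- Every quantization vector is isotropic on the unit sphere ... -/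
  codebook_aemeasurable : ∀ i k, AEMeasurable (w i k) μ
  codebook_law : ∀ i k, IsIsotropicOnSphere (μ.map (w i k))
  /-- ... and all the quantization vectors, of all the users, are independent. -/
  codebook_indep : iIndepFun (fun (p : Fin M × Fin (2 ^ B)) (ω : Ω) => w p.1 p.2 ω) μ
  /-- The codebooks are independent of the channels. -/
  channel_codebook_indep :
    IndepFun (fun (ω : Ω) (i : Fin M) => h i ω)
      (fun (ω : Ω) (i : Fin M) (k : Fin (2 ^ B)) => w i k ω) μ
  /-- User `i` feeds back a maximizer of `k ↦ |h_i† w_{i,k}|`; ties are broken in any way. -/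
  index_argmax : ∀ i, ∀ᵐ ω ∂μ, ∀ k,
    ‖inner ℂ (h i ω) (w i k ω)‖ ≤ ‖inner ℂ (h i ω) (w i (F i ω) ω)‖

/-- The matrix `[x_1 x_2 ⋯ x_M]†`, whose `i`-th row is `x_i†`. -/
def channelMatrix {M : ℕ} (x : Fin M → CVec M) : Matrix (Fin M) (Fin M) ℂ :=
  Matrix.of fun i m => star (x i m)

/-- The zero-forcing beamforming vector of user `i`: the normalized `i`-th column of the inverse
of the matrix `[x_1 ⋯ x_M]†`. -/
def zfVector {M : ℕ} (x : Fin M → CVec M) (i : Fin M) : CVec M :=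
  let c : CVec M := WithLp.toLp 2 fun m => (channelMatrix x)⁻¹ m i
  ((‖c‖⁻¹ : ℝ) : ℂ) • c

/-- The signal to interference plus noise ratio of user `i` for the channels `h`, the
beamforming vectors `v`, total power `P` split equally and unit noise variance. -/
def sinr {M : ℕ} (P : ℝ) (h v : Fin M → CVec M) (i : Fin M) : ℝ :=
  (P / M * ‖inner ℂ (h i) (v i)‖ ^ 2) /
    (1 + ∑ j ∈ Finset.univ.erase i, P / M * ‖inner ℂ (h i) (v j)‖ ^ 2)

/-- The instantaneous rate `log₂ (1 + SINR_i)` of user `i`, where zero-forcing is performed on the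
quantized channels `ĥ_j = w_{j, F_j}`. -/
def instRate {M B : ℕ} {Ω : Type*} (h : Fin M → Ω → CVec M)
    (w : Fin M → Fin (2 ^ B) → Ω → CVec M) (F : Fin M → Ω → Fin (2 ^ B))
    (P : ℝ) (i : Fin M) (ω : Ω) : ℝ :=
  Real.logb 2 (1 + sinr P (fun j => h j ω) (zfVector fun j => w j (F j ω) ω) i)

/-- The long-term average rate `R_i = E[log₂ (1 + SINR_i)]` of user `i`. -/
def userRate {M B : ℕ} {Ω : Type*} [MeasurableSpace Ω] (μ : Measure Ω)
    (h : Fin M → Ω → CVec M) (w : Fin M → Fin (2 ^ B) → Ω → CVec M)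
    (F : Fin M → Ω → Fin (2 ^ B)) (P : ℝ) (i : Fin M) : ℝ :=
  ∫ ω, instRate h w F P i ω ∂μ

/-- The system throughput `R_FB(P)`: the sum of the rates of the `M` users. -/
def throughputFB {M B : ℕ} {Ω : Type*} [MeasurableSpace Ω] (μ : Measure Ω)
    (h : Fin M → Ω → CVec M) (w : Fin M → Fin (2 ^ B) → Ω → CVec M)
    (F : Fin M → Ω → Fin (2 ^ B)) (P : ℝ) : ℝ :=
  ∑ i, userRate μ h w F P i

end FiniteRateFeedback

end

namespace FiniteRateFeedback

open MeasureTheory ProbabilityTheory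
open scoped ENNReal

noncomputable section

/-! The power cancels once the noise is dropped. Fix a user `i` and a single interferer `j ≠ i`, and
put `X_k = |h_i† v_k|²`. Keeping only the `j`-th interference term gives `SINR_i ≤ X_i / X_j`, and
since `X_i, X_j ≤ ‖h_i‖²`, also `1 + SINR_i ≤ 2 ‖h_i‖² / X_j`. Write `X_j = ‖h_i‖² Z β`, where `Z =
1 - |h_i† ĥ_i|² / ‖h_i‖²` is the quantization error and `β` is the fraction of the part of `h_i`
orthogonal to `ĥ_i` that `v_j` picks up (`v_j` is itself orthogonal to `ĥ_i`). Then `log (1 +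
SINR_i) ≤ log 2 - log Z - log β` (`ofReal_log_one_add_sinr_le`), and two logarithmic moments remain.

For one isotropic vector the error is below `x` with probability `x ^ (M - 1)`, so a union bound
over the codebook gives `P(Z < x) ≤ 2 ^ B * x ^ (M - 1)` and hence `E[-log Z] ≤ (B log 2 + 1) / (M -
1)` (`lintegral_negLog_quantized_le`).

Given the channel and codebook of user `i`, the other quantized channels are still jointly invariant
under unitary maps. Those fixing `ĥ_i` act transitively on unit vectors orthogonal to it, so the
mean of `-log β` is the same for every direction of the quantization error. That direction may
therefore be taken from a Gaussian vector, which makes `β` a Beta(1, M - 2) variable: `P(β < x) ≤ (M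
- 2) x` and `E[-log β] ≤ 1 + log (M - 2)`, while `β = 1` if `M = 2`
(`lintegral_gaussianVec_negLog_le`, `lintegral_interferenceLoss_le`).

Logarithmic losses take values in `[0, ∞]`, so integrability is a consequence of the bound. -/

lemma measurable_update_prod {ι : Type*} [DecidableEq ι] {α : ι → Type*}
    [∀ i, MeasurableSpace (α i)] (i : ι) :
    Measurable fun p : α i × (∀ i, α i) => Function.update p.2 i p.1 := by
  rw [measurable_pi_iff]
  intro k
  by_cases hk : k = i
  · subst hk; simpa using measurable_fst
  · simp only [Function.update_of_ne hk]; fun_prop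

/-- Resampling one coordinate does not change a product of probability measures. -/
lemma lintegral_pi_update {ι : Type*} [Fintype ι] [DecidableEq ι] {α : ι → Type*}
    [∀ i, MeasurableSpace (α i)] (μ : ∀ i, Measure (α i)) [∀ i, IsProbabilityMeasure (μ i)]
    (i : ι) {f : (∀ i, α i) → ℝ≥0∞} (hf : Measurable f) :
    ∫⁻ x, f x ∂Measure.pi μ = ∫⁻ c, ∫⁻ x, f (Function.update x i c) ∂Measure.pi μ ∂μ i := by
  have hm := measurable_update_prod (α := α) i
  have key : ((μ i).prod (Measure.pi μ)).map (fun p => Function.update p.2 i p.1)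
      = Measure.pi μ := by
    refine (Measure.pi_eq fun s hs => ?_).symm
    rw [Measure.map_apply hm (.univ_pi hs)]
    -- The old `i`-th coordinate is overwritten, hence unconstrained: its factor is the whole space.
    have : (fun p : α i × (∀ i, α i) => Function.update p.2 i p.1) ⁻¹' (Set.univ.pi s)
        = s i ×ˢ Set.univ.pi (Function.update s i Set.univ) := by
      ext ⟨c, x⟩
      simp only [Set.mem_preimage, Set.mem_pi, Set.mem_univ, true_implies, Set.mem_prod]
      constructor
      · intro h
        refine ⟨by simpa using h i, fun k => ?_⟩
        by_cases hk : k = i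
        · subst hk; simp
        · simpa [Function.update_of_ne hk] using h k
      · rintro ⟨h1, h2⟩ k
        by_cases hk : k = i
        · subst hk; simpa using h1
        · simpa [Function.update_of_ne hk] using h2 k
    rw [this, Measure.prod_prod, Measure.pi_pi, ← Finset.mul_prod_erase _ _ (Finset.mem_univ i),
      ← Finset.mul_prod_erase Finset.univ (fun k => μ k (s k)) (Finset.mem_univ i)]
    simp only [Function.update_self, measure_univ, one_mul]
    congr 1
    refine Finset.prod_congr rfl fun k hk => ?_
    rw [Function.update_of_ne (Finset.ne_of_mem_erase hk)]
  conv_lhs => rw [← key]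
  rw [lintegral_map hf hm]
  exact lintegral_prod (fun p => f (Function.update p.2 i p.1)) (hf.comp hm).aemeasurable

/-! ### Logarithmic moments from polynomial tails -/

/-- The function `-log` with values in `[0, ∞]`, truncated at zero, and infinite on `(-∞, 0]`. -/
def negLog (t : ℝ) : ℝ≥0∞ := if t ≤ 0 then ⊤ else ENNReal.ofReal (-Real.log t)

lemma measurable_negLog : Measurable negLog :=
  Measurable.ite measurableSet_Iic measurable_const
    (ENNReal.measurable_ofReal.comp Real.measurable_log.neg)

lemma negLog_of_pos {t : ℝ} (ht : 0 < t) : negLog t = ENNReal.ofReal (-Real.log t) :=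
  if_neg ht.not_ge

lemma negLog_mul_le {a b : ℝ} : negLog (a * b) ≤ negLog a + negLog b := by
  rcases le_or_gt a 0 with ha | ha
  · simp [negLog, ha]
  rcases le_or_gt b 0 with hb | hb
  · simp [negLog, hb]
  rw [negLog_of_pos ha, negLog_of_pos hb, negLog_of_pos (mul_pos ha hb),
    Real.log_mul ha.ne' hb.ne', neg_add]
  exact ENNReal.ofReal_add_le

/-- Let `x` decrease to zero in the tail bound. This excludes the points where `negLog` is infinite.
-/
lemma measure_nonpos_eq_zero {α : Type*} [MeasurableSpace α] (μ : Measure α) {X : α → ℝ}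
    {C : ℝ} {n : ℕ} (hn : n ≠ 0)
    (tail : ∀ x : ℝ, 0 < x → x < 1 → μ {a | X a < x} ≤ ENNReal.ofReal (C * x ^ n)) :
    μ {a | X a ≤ 0} = 0 := by
  have h1 : ∀ᶠ x in nhdsWithin (0 : ℝ) (Set.Ioi 0),
      μ {a | X a ≤ 0} ≤ ENNReal.ofReal (C * x ^ n) := by
    filter_upwards [Ioo_mem_nhdsGT (zero_lt_one (α := ℝ))] with x hx
    refine (measure_mono fun a ha => ?_).trans (tail x hx.1 hx.2)
    rw [Set.mem_ofPred_eq] at ha ⊢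
    exact ha.trans_lt hx.1
  have h2 : Filter.Tendsto (fun x : ℝ => ENNReal.ofReal (C * x ^ n))
      (nhdsWithin (0 : ℝ) (Set.Ioi 0)) (nhds 0) := by
    have : Continuous fun x : ℝ => ENNReal.ofReal (C * x ^ n) :=
      ENNReal.continuous_ofReal.comp (by fun_prop)
    have h := this.tendsto 0
    simp only [zero_pow hn, mul_zero, ENNReal.ofReal_zero] at h
    exact h.mono_left nhdsWithin_le_nhds
  exact le_antisymm (ge_of_tendsto h2 h1) bot_le

/-- A polynomial bound `μ {X < x} ≤ C x ^ n` bounds the expectation of `-log X`. -/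
lemma lintegral_negLog_le {α : Type*} [MeasurableSpace α] (μ : Measure α)
    [IsProbabilityMeasure μ] {X : α → ℝ} (hX : AEMeasurable X μ) {C : ℝ} {n : ℕ} (hC : 1 ≤ C)
    (hn : n ≠ 0)
    (tail : ∀ x : ℝ, 0 < x → x < 1 → μ {a | X a < x} ≤ ENNReal.ofReal (C * x ^ n)) :
    ∫⁻ a, negLog (X a) ∂μ ≤ ENNReal.ofReal ((Real.log C + 1) / n) := by
  have hn' : (0 : ℝ) < n := by exact_mod_cast Nat.pos_of_ne_zero hn
  have hpos : ∀ᵐ a ∂μ, 0 < X a := by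
    have := measure_nonpos_eq_zero μ hn tail
    rw [ae_iff]; simpa using this
  have h1 : ∫⁻ a, negLog (X a) ∂μ = ∫⁻ a, ENNReal.ofReal (max 0 (-Real.log (X a))) ∂μ := by
    refine lintegral_congr_ae ?_
    filter_upwards [hpos] with a ha
    rw [negLog_of_pos ha, ENNReal.ofReal_max]
    simp
  rw [h1, lintegral_eq_lintegral_meas_lt μ (f := fun a => max 0 (-Real.log (X a)))
    (Filter.Eventually.of_forall fun a => le_max_left _ _)
    (measurable_const.max Real.measurable_log.neg |>.comp_aemeasurable hX)]
  have hlog : 0 ≤ Real.log C := Real.log_nonneg hC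
  -- The tail bound `C * exp (-n t)` crosses one at `t = c`. In the layer-cake integral the
  -- probability is bounded by one up to `c`, contributing `log C / n`, and by the exponential
  -- beyond, contributing `1 / n`.
  set c := Real.log C / n with hc
  have hc0 : 0 ≤ c := by positivity
  have hb : ∀ t : ℝ, 0 < t → μ {a | t < max 0 (-Real.log (X a))}
      ≤ ENNReal.ofReal (C * Real.exp (-n * t)) := by
    intro t ht
    have hle : μ {a | t < max 0 (-Real.log (X a))} ≤ μ {a | X a < Real.exp (-t)} := by
      refine measure_mono_ae ?_
      filter_upwards [hpos] with a ha hta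
      have : t < -Real.log (X a) := (lt_max_iff.1 hta).resolve_left ht.not_gt
      exact (Real.log_lt_iff_lt_exp ha).1 (by linarith)
    refine (hle.trans (tail _ (Real.exp_pos _) (by simpa using ht))).trans_eq ?_
    rw [← Real.exp_nat_mul]
    congr 3; ring
  rw [← Set.Ioc_union_Ioi_eq_Ioi hc0, lintegral_union measurableSet_Ioi
    (Set.Ioc_disjoint_Ioi le_rfl), add_div, ENNReal.ofReal_add (by positivity) (by positivity)]
  refine add_le_add ?_ ?_
  · refine (setLIntegral_mono measurable_const fun t _ => prob_le_one).trans_eq ?_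
    simp [hc]
  · refine (setLIntegral_mono (by fun_prop) fun t (ht : t ∈ Set.Ioi c) =>
      hb t (hc0.trans_lt (Set.mem_Ioi.1 ht))).trans_eq ?_
    rw [← ofReal_integral_eq_lintegral_ofReal
      ((integrableOn_exp_mul_Ioi (neg_neg_of_pos hn') c).const_mul C)
      (Filter.Eventually.of_forall fun t => by positivity), integral_const_mul,
      integral_exp_mul_Ioi (neg_neg_of_pos hn')]
    congr 1
    rw [hc, show -(n : ℝ) * (Real.log C / n) = - Real.log C by field_simp, Real.exp_neg,
      Real.exp_log (by linarith)]
    field_simp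

/-! ### The complex Gaussian law and exponential variables -/

lemma measurable_ofReal_add_mul_I :
    Measurable fun p : ℝ × ℝ => (p.1 : ℂ) + (p.2 : ℂ) * Complex.I := by fun_prop

instance : IsProbabilityMeasure complexGaussian :=
  Measure.isProbabilityMeasure_map measurable_ofReal_add_mul_I.aemeasurable

/-- The dependence on `‖t‖ ^ 2` alone is what later yields unitary invariance of Gaussian vectors.
-/
lemma charFun_complexGaussian (t : ℂ) :
    charFun complexGaussian t = Complex.exp (-(‖t‖ ^ 2 / 4 : ℝ)) := by
  rw [charFun_apply, complexGaussian,
    integral_map measurable_ofReal_add_mul_I.aemeasurable (by fun_prop)]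
  have h : ∀ p : ℝ × ℝ,
      Complex.exp ((inner ℝ ((p.1 : ℂ) + (p.2 : ℂ) * Complex.I) t : ℝ) * Complex.I)
        = Complex.exp (t.re * p.1 * Complex.I) * Complex.exp (t.im * p.2 * Complex.I) := by
    intro p
    rw [← Complex.exp_add, Complex.inner]
    congr 1
    simp
    ring
  simp_rw [h]
  rw [integral_prod_mul (fun x : ℝ => Complex.exp (t.re * x * Complex.I))
    (fun x : ℝ => Complex.exp (t.im * x * Complex.I)), ← charFun_apply_real, ← charFun_apply_real,
    charFun_gaussianReal, charFun_gaussianReal, ← Complex.exp_add, Complex.sq_norm,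
    Complex.normSq_apply]
  congr 1
  push_cast
  ring

lemma integral_exp_sq_gaussianReal {c : ℝ} (hc : 0 ≤ c) :
    ∫ x, Real.exp (-c * x ^ 2) ∂gaussianReal 0 (1 / 2) = √(1 / (1 + c)) := by
  rw [integral_gaussianReal_eq_integral_smul (by norm_num)]
  have h : ∀ x : ℝ, gaussianPDFReal 0 (1 / 2) x • Real.exp (-c * x ^ 2)
      = (√Real.pi)⁻¹ * Real.exp (-(1 + c) * x ^ 2) := by
    intro x
    rw [gaussianPDFReal, smul_eq_mul, mul_assoc, ← Real.exp_add]
    congr 2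
    · push_cast; ring_nf
    · push_cast; ring
  simp_rw [h]
  rw [integral_const_mul, integral_gaussian, ← Real.sqrt_inv, ← Real.sqrt_mul (by positivity)]
  congr 1
  have := Real.pi_pos
  field_simp

lemma mgf_norm_sq_complexGaussian {c : ℝ} (hc : 0 ≤ c) :
    mgf (fun z : ℂ => ‖z‖ ^ 2) complexGaussian (-c) = (1 + c)⁻¹ := by
  rw [mgf, complexGaussian, integral_map measurable_ofReal_add_mul_I.aemeasurable (by fun_prop)]
  have h : ∀ p : ℝ × ℝ, Real.exp (-c * ‖(p.1 : ℂ) + (p.2 : ℂ) * Complex.I‖ ^ 2)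
        = Real.exp (-c * p.1 ^ 2) * Real.exp (-c * p.2 ^ 2) := by
    intro p
    rw [← Real.exp_add, Complex.sq_norm, Complex.normSq_add_mul_I]
    congr 1
    ring
  simp_rw [h]
  rw [integral_prod_mul (fun x : ℝ => Real.exp (-c * x ^ 2))
    (fun x : ℝ => Real.exp (-c * x ^ 2)), integral_exp_sq_gaussianReal hc,
    Real.mul_self_sqrt (by positivity), one_div]

/-- The squared modulus of a complex Gaussian is exponentially distributed. -/
lemma complexGaussian_le_norm_sq {t : ℝ} (ht : 0 ≤ t) :
    complexGaussian {z | t ≤ ‖z‖ ^ 2} = ENNReal.ofReal (Real.exp (-t)) := by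
  have hm : MeasurableSet {z : ℂ | t ≤ ‖z‖ ^ 2} :=
    measurableSet_le measurable_const (by fun_prop)
  have hp : (gaussianReal 0 (1 / 2)).prod (gaussianReal 0 (1 / 2))
      = volume.withDensity fun p : ℝ × ℝ =>
        ENNReal.ofReal (Real.pi⁻¹ * Real.exp (-(p.1 ^ 2 + p.2 ^ 2))) := by
    rw [gaussianReal_of_var_ne_zero _ (by norm_num),
      prod_withDensity (by fun_prop) (by fun_prop)]
    congr 1
    ext p
    rw [gaussianPDF, gaussianPDF, ← ENNReal.ofReal_mul (gaussianPDFReal_nonneg _ _ _)]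
    congr 1
    rw [gaussianPDFReal, gaussianPDFReal, mul_mul_mul_comm, ← Real.exp_add, ← mul_inv]
    congr 2
    · rw [Real.mul_self_sqrt (by positivity)]; push_cast; ring
    · push_cast; ring
  rw [complexGaussian, Measure.map_apply measurable_ofReal_add_mul_I hm, hp,
    withDensity_apply _ (measurable_ofReal_add_mul_I hm),
    ← lintegral_indicator (measurable_ofReal_add_mul_I hm), ← lintegral_comp_polarCoord_symm]
  -- In polar coordinates the integrand does not involve the angle, which will contribute a factor
  -- `2π`; the radial integral has an explicit primitive.
  have h : ∀ p ∈ polarCoord.target, ENNReal.ofReal p.1 •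
      ((fun p : ℝ × ℝ => (p.1 : ℂ) + (p.2 : ℂ) * Complex.I) ⁻¹' {z : ℂ | t ≤ ‖z‖ ^ 2}).indicator
        (fun p : ℝ × ℝ => ENNReal.ofReal (Real.pi⁻¹ * Real.exp (-(p.1 ^ 2 + p.2 ^ 2))))
        (polarCoord.symm p) =
      (Set.Ici (√t)).indicator
        (fun r => ENNReal.ofReal (Real.pi⁻¹ * (r * Real.exp (-r ^ 2)))) p.1 := by
    rintro ⟨r, θ⟩ ⟨hr : 0 < r, -⟩
    have h1 : (r * Real.cos θ) ^ 2 + (r * Real.sin θ) ^ 2 = r ^ 2 := by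
      linear_combination r ^ 2 * Real.cos_sq_add_sin_sq θ
    have h2 : polarCoord.symm (r, θ) ∈ ((fun p : ℝ × ℝ => (p.1 : ℂ) + (p.2 : ℂ) * Complex.I) ⁻¹'
        {z : ℂ | t ≤ ‖z‖ ^ 2}) ↔ r ∈ Set.Ici (√t) := by
      simp only [Set.mem_preimage, Set.mem_ofPred_eq, Complex.sq_norm, Complex.normSq_add_mul_I,
        polarCoord_symm_apply, h1, Set.mem_Ici]
      exact (Real.sqrt_le_left hr.le).symm
    by_cases hr' : r ∈ Set.Ici (√t)
    · rw [Set.indicator_of_mem (h2.2 hr'), Set.indicator_of_mem hr', smul_eq_mul,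
        ← ENNReal.ofReal_mul hr.le]
      simp only [polarCoord_symm_apply, h1]
      congr 1; ring
    · rw [Set.indicator_of_notMem (h2.not.2 hr'), Set.indicator_of_notMem hr', smul_zero]
  rw [setLIntegral_congr_fun polarCoord.open_target.measurableSet h, polarCoord_target,
    Measure.volume_eq_prod, setLIntegral_prod _ (by
      refine (Measurable.indicator ?_ measurableSet_Ici).aemeasurable.comp_fst |>.restrict
      fun_prop)]
  simp only [lintegral_const, Measure.restrict_apply MeasurableSet.univ, Set.univ_inter,
    Real.volume_Ioo]
  have hπ := Real.pi_pos
  have hI : (Set.Ici (√t) ∩ Set.Ioi 0 : Set ℝ) =ᵐ[volume] Set.Ioi (√t) := by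
    have : (Set.Ioi (√t) ∩ Set.Ioi 0 : Set ℝ) = Set.Ioi (√t) :=
      Set.inter_eq_left.2 (Set.Ioi_subset_Ioi (Real.sqrt_nonneg t))
    rw [← this]
    exact Ioi_ae_eq_Ici.symm.inter Filter.EventuallyEq.rfl
  have hd : ∀ r ∈ Set.Ici (√t), HasDerivAt (fun r : ℝ => -(2 * Real.pi)⁻¹ * Real.exp (-r ^ 2))
      (Real.pi⁻¹ * (r * Real.exp (-r ^ 2))) r := by
    intro r _
    have h := (((hasDerivAt_id' r).fun_pow 2).fun_neg.exp).const_mul (-(2 * Real.pi)⁻¹)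
    refine h.congr_deriv ?_
    push_cast
    field_simp
  have hlim : Filter.Tendsto (fun r : ℝ => -(2 * Real.pi)⁻¹ * Real.exp (-r ^ 2)) Filter.atTop
      (nhds (-(2 * Real.pi)⁻¹ * 0)) :=
    (Real.tendsto_exp_neg_atTop_nhds_zero.comp
      (Filter.tendsto_pow_atTop two_ne_zero)).const_mul _
  have hnn : ∀ r ∈ Set.Ioi (√t), 0 ≤ Real.pi⁻¹ * (r * Real.exp (-r ^ 2)) := fun r hr => by
    have : 0 < r := (Real.sqrt_nonneg t).trans_lt hr
    positivity
  rw [lintegral_mul_const _ (Measurable.indicator (by fun_prop) measurableSet_Ici),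
    lintegral_indicator measurableSet_Ici, Measure.restrict_restrict measurableSet_Ici,
    setLIntegral_congr hI, ← ofReal_integral_eq_lintegral_ofReal
      (integrableOn_Ioi_deriv_of_nonneg' hd hnn hlim)
      ((ae_restrict_iff' measurableSet_Ioi).2 (Filter.Eventually.of_forall hnn)),
    integral_Ioi_of_hasDerivAt_of_nonneg' hd hnn hlim, ← ENNReal.ofReal_mul' (by linarith),
    Real.sq_sqrt ht]
  congr 1
  field_simp
  ring

/-- The tail `exp (-t)` is continuous, so the law of `‖z‖ ^ 2` has no atoms. -/
lemma complexGaussian_norm_sq_eq (t : ℝ) : complexGaussian {z | ‖z‖ ^ 2 = t} = 0 := by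
  rcases lt_or_ge t 0 with ht | ht
  · convert measure_empty (μ := complexGaussian)
    ext z
    simp only [Set.mem_ofPred_eq, Set.mem_empty_iff_false, iff_false]
    nlinarith [sq_nonneg ‖z‖]
  have h1 : ∀ᶠ s in nhdsWithin t (Set.Ioi t), complexGaussian {z | ‖z‖ ^ 2 = t}
      ≤ ENNReal.ofReal (Real.exp (-t)) - ENNReal.ofReal (Real.exp (-s)) := by
    filter_upwards [self_mem_nhdsWithin] with s hs
    rw [← complexGaussian_le_norm_sq ht, ← complexGaussian_le_norm_sq (ht.trans (le_of_lt hs))]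
    have hsub : {z : ℂ | s ≤ ‖z‖ ^ 2} ⊆ {z | t ≤ ‖z‖ ^ 2} := by
      intro z hz
      rw [Set.mem_ofPred_eq] at hz ⊢
      exact (le_of_lt hs).trans hz
    rw [← measure_sdiff hsub
      (measurableSet_le measurable_const (by fun_prop)).nullMeasurableSet (measure_ne_top _ _)]
    refine measure_mono fun z hz => ?_
    rw [Set.mem_ofPred_eq] at hz
    simpa [hz] using hs
  have h2 : Filter.Tendsto (fun s : ℝ => ENNReal.ofReal (Real.exp (-t)) -
      ENNReal.ofReal (Real.exp (-s))) (nhdsWithin t (Set.Ioi t)) (nhds 0) := by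
    rw [← tsub_self (ENNReal.ofReal (Real.exp (-t)))]
    refine ENNReal.Tendsto.sub tendsto_const_nhds ?_ (Or.inl ENNReal.ofReal_ne_top)
    have : Continuous fun s : ℝ => ENNReal.ofReal (Real.exp (-s)) :=
      ENNReal.continuous_ofReal.comp (by fun_prop)
    exact (this.tendsto t).mono_left nhdsWithin_le_nhds
  exact le_antisymm (ge_of_tendsto h2 h1) bot_le

/-- For independent exponential variables `E i`, the probability of `c * ∑ m ∈ A, E m ≤ E i`. -/
lemma pi_complexGaussian_mul_sum_le {ι : Type*} [Fintype ι] [DecidableEq ι] (i : ι)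
    {A : Finset ι} (hi : i ∉ A) {c : ℝ} (hc : 0 ≤ c) :
    Measure.pi (fun _ : ι => complexGaussian) {z | c * ∑ m ∈ A, ‖z m‖ ^ 2 ≤ ‖z i‖ ^ 2}
      = ENNReal.ofReal ((1 + c)⁻¹ ^ A.card) := by
  have hS : MeasurableSet {z : ι → ℂ | c * ∑ m ∈ A, ‖z m‖ ^ 2 ≤ ‖z i‖ ^ 2} :=
    measurableSet_le (by fun_prop) (by fun_prop)
  -- Integrating the `i`-th coordinate first turns the event into `exp (-c * ∑ m ∈ A, ‖z m‖ ^ 2)`.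
  -- What remains is a Laplace transform, which factors over `A` by independence.
  rw [← lintegral_indicator_one hS, lintegral_pi_update _ i (measurable_one.indicator hS),
    lintegral_lintegral_swap]
  · have h : ∀ z : ι → ℂ, ∫⁻ x, {z : ι → ℂ | c * ∑ m ∈ A, ‖z m‖ ^ 2 ≤ ‖z i‖ ^ 2}.indicator 1
        (Function.update z i x) ∂complexGaussian
        = ENNReal.ofReal (Real.exp (-c * ∑ m ∈ A, ‖z m‖ ^ 2)) := by
      intro z
      rw [neg_mul, ← complexGaussian_le_norm_sq (by positivity), ← lintegral_indicator_one
        (measurableSet_le measurable_const (by fun_prop))]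
      refine lintegral_congr fun x => ?_
      have : ∑ m ∈ A, ‖Function.update z i x m‖ ^ 2 = ∑ m ∈ A, ‖z m‖ ^ 2 :=
        Finset.sum_congr rfl fun m hm => by
          rw [Function.update_of_ne (ne_of_mem_of_not_mem hm hi)]
      simp only [Set.indicator, Set.mem_ofPred_eq, this, Function.update_self]
      rfl
    simp_rw [h]
    have hind : iIndepFun (fun m (z : ι → ℂ) => ‖z m‖ ^ 2)
        (Measure.pi fun _ : ι => complexGaussian) :=
      iIndepFun_pi (μ := fun _ : ι => complexGaussian) (X := fun _ z => ‖z‖ ^ 2)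
        fun _ => by fun_prop
    have hs := hind.mgf_sum (t := -c) (fun m => by fun_prop) A
    have hb : Integrable (fun z : ι → ℂ => Real.exp (-c * ∑ m ∈ A, ‖z m‖ ^ 2))
        (Measure.pi fun _ : ι => complexGaussian) := by
      refine Integrable.of_bound (Measurable.aestronglyMeasurable (by fun_prop)) 1 (Filter.Eventually.of_forall fun z => ?_)
      rw [Real.norm_eq_abs, Real.abs_exp, Real.exp_le_one_iff]
      have : 0 ≤ c * ∑ m ∈ A, ‖z m‖ ^ 2 := by positivity
      linarith
    rw [← ofReal_integral_eq_lintegral_ofReal hb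
      (Filter.Eventually.of_forall fun t => (Real.exp_pos _).le)]
    congr 1
    simp only [mgf, Finset.sum_apply] at hs
    rw [hs, ← Finset.prod_const]
    refine Finset.prod_congr rfl fun m _ => ?_
    rw [← mgf_norm_sq_complexGaussian hc, mgf]
    exact integral_comp_eval (μ := fun _ : ι => complexGaussian) (i := m)
      (f := fun z : ℂ => Real.exp (-c * ‖z‖ ^ 2)) (by fun_prop)
  · have hm := measurable_update_prod (α := fun _ : ι => ℂ) i
    exact ((measurable_one.indicator hS).comp hm).aemeasurable

/-! ### Gaussian vectors: unitary invariance, projections onto one or two directions -/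

section Vectors

variable {M : ℕ}

/-- The law of a channel vector with independent unit variance complex Gaussian entries. -/
def gaussianVec (M : ℕ) : Measure (CVec M) :=
  (Measure.pi fun _ : Fin M => complexGaussian).map (WithLp.toLp 2)

instance : IsProbabilityMeasure (gaussianVec M) :=
  Measure.isProbabilityMeasure_map (by fun_prop)

lemma charFun_gaussianVec (t : CVec M) :
    charFun (gaussianVec M) t = Complex.exp (-(‖t‖ ^ 2 / 4 : ℝ)) := by
  rw [gaussianVec, charFun_pi]
  simp_rw [charFun_complexGaussian]
  rw [← Complex.exp_sum, EuclideanSpace.norm_sq_eq]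
  congr 1
  push_cast
  rw [Finset.sum_neg_distrib, Finset.sum_div]

lemma gaussianVec_map (U : CVec M ≃ₗᵢ[ℂ] CVec M) : (gaussianVec M).map U = gaussianVec M := by
  have hU : Measurable U := U.continuous.measurable
  have : IsProbabilityMeasure ((gaussianVec M).map U) :=
    Measure.isProbabilityMeasure_map hU.aemeasurable
  refine Measure.ext_of_charFun (funext fun t => ?_)
  -- The characteristic function uses the real inner product; polarization expresses it through
  -- norms, which `U` preserves.
  have h : ∀ x : CVec M, inner ℝ (U x) t = inner ℝ x (U.symm t) := by
    intro x
    rw [real_inner_eq_norm_add_mul_self_sub_norm_mul_self_sub_norm_mul_self_div_two,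
      real_inner_eq_norm_add_mul_self_sub_norm_mul_self_sub_norm_mul_self_div_two,
      ← U.norm_map (x + _), map_add, U.apply_symm_apply, U.norm_map, U.symm.norm_map]
  rw [charFun_apply, integral_map hU.aemeasurable (by fun_prop)]
  simp_rw [h]
  rw [← charFun_apply, charFun_gaussianVec, charFun_gaussianVec, U.symm.norm_map]

lemma lintegral_gaussianVec_map (U : CVec M ≃ₗᵢ[ℂ] CVec M) {f : CVec M → ℝ≥0∞}
    (hf : Measurable f) :
    ∫⁻ g, f (U g) ∂gaussianVec M
      = ∫⁻ z, f (WithLp.toLp 2 z) ∂Measure.pi fun _ : Fin M => complexGaussian := by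
  rw [← lintegral_map hf U.continuous.measurable, gaussianVec_map, gaussianVec,
    lintegral_map hf (by fun_prop)]

lemma gaussianVec_preimage (U : CVec M ≃ₗᵢ[ℂ] CVec M) {s : Set (CVec M)} (hs : MeasurableSet s) :
    gaussianVec M (U ⁻¹' s)
      = Measure.pi (fun _ : Fin M => complexGaussian) (WithLp.toLp 2 ⁻¹' s) := by
  rw [← Measure.map_apply U.continuous.measurable hs, gaussianVec_map, gaussianVec,
    Measure.map_apply (by fun_prop) hs]

/-- Extend `a, b` to an orthonormal basis and take its coordinate map. -/
lemma exists_isometry_pair_single {i j : Fin M} (hij : i ≠ j) {a b : CVec M} (ha : ‖a‖ = 1)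
    (hb : ‖b‖ = 1) (hab : inner ℂ a b = 0) :
    ∃ U : CVec M ≃ₗᵢ[ℂ] CVec M,
      U a = EuclideanSpace.single i 1 ∧ U b = EuclideanSpace.single j 1 := by
  have hv : Orthonormal ℂ (Set.domRestrict ({i, j} : Set (Fin M))
      (fun k => if k = i then a else b)) := by
    constructor
    · rintro ⟨k, hk⟩
      by_cases h : k = i <;> simp [h, ha, hb]
    · rintro ⟨k, hk⟩ ⟨l, hl⟩ hkl
      have hba : inner ℂ b a = 0 := inner_eq_zero_symm.1 hab
      simp only [Set.mem_insert_iff, Set.mem_singleton_iff] at hk hl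
      rcases hk with rfl | rfl <;> rcases hl with rfl | rfl <;>
        simp_all [hij.symm]
  obtain ⟨e, he⟩ := hv.exists_orthonormalBasis_extension_of_card_eq (by simp)
  refine ⟨e.repr, ?_, ?_⟩
  · have := he i (by simp)
    rw [if_pos rfl] at this
    rw [← this, e.repr_self]
  · have := he j (by simp)
    rw [if_neg hij.symm] at this
    rw [← this, e.repr_self]

lemma exists_isometry_single (i : Fin M) {a : CVec M} (ha : ‖a‖ = 1) :
    ∃ U : CVec M ≃ₗᵢ[ℂ] CVec M, U a = EuclideanSpace.single i 1 := by
  have hv : Orthonormal ℂ (Set.domRestrict ({i} : Set (Fin M)) (fun _ => a)) := by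
    constructor
    · intro k
      simp [ha]
    · intro k l hkl
      exact absurd (Subsingleton.elim k l) hkl
  obtain ⟨e, he⟩ := hv.exists_orthonormalBasis_extension_of_card_eq (by simp)
  refine ⟨e.repr, ?_⟩
  rw [← he i (by simp), e.repr_self]

lemma norm_inner_eq_of_map_eq_single {U : CVec M ≃ₗᵢ[ℂ] CVec M} {a : CVec M} {i : Fin M}
    (h : U a = EuclideanSpace.single i 1) (g : CVec M) : ‖inner ℂ g a‖ = ‖U g i‖ := by
  rw [← U.inner_map_map, h, EuclideanSpace.inner_single_right]
  simp

/-- Once the other coordinates are frozen, `r` is constant and `‖z i‖ ^ 2` has no atoms. -/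
lemma pi_complexGaussian_norm_sq_eq {ι : Type*} [Fintype ι] [DecidableEq ι] (i : ι)
    {r : (ι → ℂ) → ℝ} (hr : Measurable r) (h : ∀ z c, r (Function.update z i c) = r z) :
    Measure.pi (fun _ : ι => complexGaussian) {z | ‖z i‖ ^ 2 = r z} = 0 := by
  have hS : MeasurableSet {z : ι → ℂ | ‖z i‖ ^ 2 = r z} :=
    measurableSet_eq_fun (by fun_prop) hr
  have hm := measurable_update_prod (α := fun _ : ι => ℂ) i
  rw [← lintegral_indicator_one hS, lintegral_pi_update _ i (measurable_one.indicator hS),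
    lintegral_lintegral_swap (by exact ((measurable_one.indicator hS).comp hm).aemeasurable)]
  refine (lintegral_congr fun z => ?_).trans (lintegral_zero (μ := Measure.pi _))
  rw [← complexGaussian_norm_sq_eq (r z), ← lintegral_indicator_one
    (measurableSet_eq_fun (by fun_prop) measurable_const)]
  refine lintegral_congr fun x => ?_
  simp only [Set.indicator, Set.mem_ofPred_eq, h, Function.update_self]
  rfl

/-- Rotating `a` to a basis vector turns the event into a comparison of one exponential variable
with `(1 - x) / x` times the sum of the `M - 1` others. This factor is chosen so that `(1 + c)⁻¹ =
x`. -/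
lemma gaussianVec_one_sub_le {a : CVec M} (ha : ‖a‖ = 1) {x : ℝ} (hx0 : 0 < x) (hx1 : x < 1) :
    gaussianVec M {g | 1 - ‖inner ℂ g a‖ ^ 2 / ‖g‖ ^ 2 < x}
      ≤ ENNReal.ofReal (x ^ (M - 1)) := by
  have hM : 0 < M := by
    rcases Nat.eq_zero_or_pos M with rfl | h
    · rw [Subsingleton.elim a 0] at ha; simp at ha
    · exact h
  let i : Fin M := ⟨0, hM⟩
  obtain ⟨U, hU⟩ := exists_isometry_single i ha
  have hS : MeasurableSet {g : CVec M | 1 - ‖g i‖ ^ 2 / ‖g‖ ^ 2 < x} :=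
    measurableSet_lt (by fun_prop) measurable_const
  have h1 : gaussianVec M {g | 1 - ‖inner ℂ g a‖ ^ 2 / ‖g‖ ^ 2 < x}
      = Measure.pi (fun _ : Fin M => complexGaussian)
        {z | 1 - ‖z i‖ ^ 2 / ∑ m, ‖z m‖ ^ 2 < x} := by
    have hset : {g | 1 - ‖inner ℂ g a‖ ^ 2 / ‖g‖ ^ 2 < x}
        = U ⁻¹' {g | 1 - ‖g i‖ ^ 2 / ‖g‖ ^ 2 < x} := by
      ext g
      simp [norm_inner_eq_of_map_eq_single hU, U.norm_map]
    rw [hset, gaussianVec_preimage U hS]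
    congr 1
    ext z
    simp [EuclideanSpace.norm_sq_eq]
  have hcard : (Finset.univ.erase i).card = M - 1 := by simp
  have h2 := pi_complexGaussian_mul_sum_le i (Finset.notMem_erase i Finset.univ)
    (c := (1 - x) / x) (div_nonneg (by linarith) hx0.le)
  rw [show (1 + (1 - x) / x)⁻¹ = x by field_simp; ring, hcard] at h2
  rw [h1, ← h2]
  refine measure_mono fun z hz => ?_
  rw [Set.mem_ofPred_eq] at hz ⊢
  rw [← Finset.add_sum_erase _ _ (Finset.mem_univ i)] at hz
  have hs : 0 ≤ ∑ m ∈ Finset.univ.erase i, ‖z m‖ ^ 2 := Finset.sum_nonneg fun _ _ => sq_nonneg _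
  set s := ∑ m ∈ Finset.univ.erase i, ‖z m‖ ^ 2
  have he := sq_nonneg ‖z i‖
  rcases (add_nonneg he hs).eq_or_lt with h0 | h0
  -- At the zero vector the quotient is `0` by convention, so the event would read `1 < x`.
  · rw [← h0] at hz; simp at hz; linarith
  · rw [sub_lt_iff_lt_add, ← sub_lt_iff_lt_add', lt_div_iff₀ h0] at hz
    rw [div_mul_eq_mul_div, div_le_iff₀ hx0]
    nlinarith

lemma gaussianVec_norm_inner_sq_eq (hM : 2 ≤ M) {a : CVec M} (ha : ‖a‖ = 1) (ρ : ℝ) :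
    gaussianVec M {g | ‖inner ℂ g a‖ ^ 2 = ρ * ‖g‖ ^ 2} = 0 := by
  let i : Fin M := ⟨0, by omega⟩
  let j : Fin M := ⟨1, by omega⟩
  have hij : i ≠ j := by simp [i, j]
  obtain ⟨U, hU⟩ := exists_isometry_single i ha
  have h1 : gaussianVec M {g | ‖inner ℂ g a‖ ^ 2 = ρ * ‖g‖ ^ 2}
      = Measure.pi (fun _ : Fin M => complexGaussian)
        {z | ‖z i‖ ^ 2 = ρ * ∑ m, ‖z m‖ ^ 2} := by
    have hset : {g | ‖inner ℂ g a‖ ^ 2 = ρ * ‖g‖ ^ 2}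
        = U ⁻¹' {g | ‖g i‖ ^ 2 = ρ * ‖g‖ ^ 2} := by
      ext g
      simp [norm_inner_eq_of_map_eq_single hU, U.norm_map]
    rw [hset, gaussianVec_preimage U (measurableSet_eq_fun (by fun_prop) (by fun_prop))]
    congr 1
    ext z
    simp [EuclideanSpace.norm_sq_eq]
  rw [h1]
  rcases eq_or_ne ρ 0 with rfl | hρ
  · simpa using pi_complexGaussian_norm_sq_eq i (r := fun _ => 0) measurable_const (by simp)
  -- Solve the equation for the coordinate `j`, whose square then equals a function of the other
  -- coordinates.
  · refine measure_mono_null (fun z hz => ?_) (pi_complexGaussian_norm_sq_eq j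
      (r := fun z => ‖z i‖ ^ 2 / ρ - ∑ m ∈ Finset.univ.erase j, ‖z m‖ ^ 2) (by fun_prop) ?_)
    · rw [Set.mem_ofPred_eq] at hz ⊢
      rw [hz, mul_div_cancel_left₀ _ hρ, ← Finset.add_sum_erase _ _ (Finset.mem_univ j)]
      ring
    · intro z c
      rw [Function.update_of_ne hij]
      congr 1
      exact Finset.sum_congr rfl fun m hm => by
        rw [Function.update_of_ne (Finset.ne_of_mem_erase hm)]

/-- An upper bound, in nats, for the mean of `-log` of a Beta(1, M - 2) variable. -/
def betaBound (M : ℕ) : ℝ := if M = 2 then 0 else 1 + Real.log (M - 2)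

lemma betaBound_nonneg (hM : 2 ≤ M) : 0 ≤ betaBound M := by
  unfold betaBound
  split_ifs with h
  · exact le_rfl
  · have h3 : (3 : ℝ) ≤ M := by exact_mod_cast (by omega : 3 ≤ M)
    have := Real.log_nonneg (x := (M : ℝ) - 2) (by linarith)
    linarith

/-- After rotating `a, b` to basis vectors, the ratio is one exponential variable over its sum with
the `M - 2` variables indexed by `A`. For `M = 2` the set `A` is empty and the ratio is one almost
surely. -/
lemma lintegral_gaussianVec_negLog_le (hM : 2 ≤ M) {a b : CVec M} (ha : ‖a‖ = 1) (hb : ‖b‖ = 1)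
    (hab : inner ℂ a b = 0) :
    ∫⁻ g, negLog (‖inner ℂ g b‖ ^ 2 / (‖g‖ ^ 2 - ‖inner ℂ g a‖ ^ 2)) ∂gaussianVec M
      ≤ ENNReal.ofReal (betaBound M) := by
  let i : Fin M := ⟨0, by omega⟩
  let j : Fin M := ⟨1, by omega⟩
  have hij : i ≠ j := by simp [i, j]
  obtain ⟨U, hUa, hUb⟩ := exists_isometry_pair_single hij ha hb hab
  set A : Finset (Fin M) := (Finset.univ.erase i).erase j
  have hcard : A.card = M - 2 := by
    rw [Finset.card_erase_of_mem (by simp [hij.symm]), Finset.card_erase_of_mem (by simp)]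
    simp; omega
  have hsum : ∀ z : Fin M → ℂ, ∑ m, ‖z m‖ ^ 2 - ‖z i‖ ^ 2 = ‖z j‖ ^ 2 + ∑ m ∈ A, ‖z m‖ ^ 2 := by
    intro z
    rw [Finset.add_sum_erase _ (fun m => ‖z m‖ ^ 2) (by simp [hij.symm]),
      ← Finset.add_sum_erase _ _ (Finset.mem_univ i)]
    ring
  have h1 : ∫⁻ g, negLog (‖inner ℂ g b‖ ^ 2 / (‖g‖ ^ 2 - ‖inner ℂ g a‖ ^ 2)) ∂gaussianVec M
      = ∫⁻ z, negLog (‖z j‖ ^ 2 / (‖z j‖ ^ 2 + ∑ m ∈ A, ‖z m‖ ^ 2))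
        ∂Measure.pi fun _ : Fin M => complexGaussian := by
    have := lintegral_gaussianVec_map U
      (f := fun g => negLog (‖g j‖ ^ 2 / (‖g‖ ^ 2 - ‖g i‖ ^ 2)))
      (measurable_negLog.comp (by fun_prop))
    simpa [norm_inner_eq_of_map_eq_single hUa, norm_inner_eq_of_map_eq_single hUb,
      EuclideanSpace.norm_sq_eq, hsum] using this
  have h0 : ∀ᵐ z ∂Measure.pi fun _ : Fin M => complexGaussian, ‖z j‖ ^ 2 ≠ 0 :=
    measure_mono_null (fun z hz => by simpa using hz)
      (pi_complexGaussian_norm_sq_eq j (r := fun _ => 0) measurable_const (by simp))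
  rw [h1, betaBound]
  split_ifs with h2
  · have hA : A = ∅ := Finset.card_eq_zero.1 (by omega)
    refine (lintegral_congr_ae (g := fun _ => 0) ?_).trans_le (by simp)
    filter_upwards [h0] with z hz
    rw [hA, Finset.sum_empty, add_zero, div_self hz, negLog_of_pos one_pos]
    simp
  · have h3 : 3 ≤ M := by omega
    have h3' : (3 : ℝ) ≤ M := by exact_mod_cast h3
    refine (lintegral_negLog_le _ (Measurable.aemeasurable (by fun_prop)) (C := M - 2) (n := 1)
      (by linarith) one_ne_zero ?_).trans_eq (by simp [add_comm])
    intro x hx0 hx1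
    -- The ratio is at least `x` exactly when `‖z j‖ ^ 2` is at least `c` times the sum over `A`;
    -- moreover `(1 + c)⁻¹ = 1 - x`.
    set c := x / (1 - x) with hc
    have hc0 : 0 ≤ c := div_nonneg hx0.le (by linarith)
    have hS : MeasurableSet {z : Fin M → ℂ | c * ∑ m ∈ A, ‖z m‖ ^ 2 ≤ ‖z j‖ ^ 2} :=
      measurableSet_le (by fun_prop) (by fun_prop)
    have hle : Measure.pi (fun _ : Fin M => complexGaussian)
        {z | ‖z j‖ ^ 2 / (‖z j‖ ^ 2 + ∑ m ∈ A, ‖z m‖ ^ 2) < x}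
        ≤ Measure.pi (fun _ : Fin M => complexGaussian)
          {z : Fin M → ℂ | c * ∑ m ∈ A, ‖z m‖ ^ 2 ≤ ‖z j‖ ^ 2}ᶜ := by
      refine measure_mono_ae ?_
      filter_upwards [h0] with z hz hzx
      have hzx' : ‖z j‖ ^ 2 / (‖z j‖ ^ 2 + ∑ m ∈ A, ‖z m‖ ^ 2) < x := hzx
      have hs : 0 ≤ ∑ m ∈ A, ‖z m‖ ^ 2 := Finset.sum_nonneg fun _ _ => sq_nonneg _
      have hpos : 0 < ‖z j‖ ^ 2 := (sq_nonneg _).lt_of_ne' hz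
      rw [div_lt_iff₀ (by linarith)] at hzx'
      change ¬ (c * ∑ m ∈ A, ‖z m‖ ^ 2 ≤ ‖z j‖ ^ 2)
      rw [not_le, hc, div_mul_eq_mul_div, lt_div_iff₀ (by linarith)]
      nlinarith
    refine hle.trans ?_
    rw [prob_compl_eq_one_sub hS, pi_complexGaussian_mul_sum_le j (by simp [A]) hc0, hcard,
      show (1 + c)⁻¹ = 1 - x by
        rw [hc, show 1 + x / (1 - x) = 1 / (1 - x) by
          have : 1 - x ≠ 0 := by linarith
          field_simp; ring, one_div, inv_inv],
      ← ENNReal.ofReal_one, ← ENNReal.ofReal_sub _ (pow_nonneg (by linarith) _)]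
    refine ENNReal.ofReal_le_ofReal ?_
    -- Bernoulli's inequality: `1 - (1 - x) ^ (M - 2) ≤ (M - 2) * x`.
    have := one_add_mul_le_pow (a := -x) (by linarith) (M - 2)
    rw [Nat.cast_sub hM, ← sub_eq_add_neg] at this
    push_cast at this
    rw [pow_one]
    nlinarith

/-! ### Zero-forcing vectors: measurability, equivariance, orthogonality -/

lemma measurable_zfVector (j : Fin M) :
    Measurable fun y : Fin M → CVec M => zfVector y j := by
  have hA : Continuous fun y : Fin M → CVec M => channelMatrix y := by
    refine continuous_matrix fun k m => ?_
    simp only [channelMatrix, Matrix.of_apply]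
    fun_prop
  have hinv : ∀ m, Measurable fun y : Fin M → CVec M => (channelMatrix y)⁻¹ m j := by
    intro m
    simp only [Matrix.inv_def, Ring.inverse_eq_inv', Matrix.smul_apply, smul_eq_mul]
    exact hA.matrix_det.measurable.inv.mul (hA.matrix_adjugate.matrix_elem m j).measurable
  have hc : Measurable fun y : Fin M → CVec M =>
      (WithLp.toLp 2 fun m => (channelMatrix y)⁻¹ m j : CVec M) :=
    (WithLp.measurable_toLp 2 _).comp (measurable_pi_lambda _ hinv)
  exact (Complex.measurable_ofReal.comp hc.norm.inv).smul hc

lemma isometry_apply_eq_sum (U : CVec M ≃ₗᵢ[ℂ] CVec M) (v : CVec M) (l : Fin M) :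
    U v l = ∑ m, U (EuclideanSpace.single m 1) l * v m := by
  conv_lhs => rw [← (EuclideanSpace.basisFun (Fin M) ℂ).sum_repr v]
  simp [mul_comm]

lemma channelMatrix_map (U : CVec M ≃ₗᵢ[ℂ] CVec M) (y : Fin M → CVec M) :
    channelMatrix (fun k => U (y k))
      = channelMatrix y * Matrix.of fun l m => U.symm (EuclideanSpace.single m 1) l := by
  ext k m
  have h : inner ℂ (U (y k)) (EuclideanSpace.single m 1)
      = inner ℂ (y k) (U.symm (EuclideanSpace.single m 1)) := by
    rw [← U.inner_map_map (y k), U.apply_symm_apply]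
  rw [EuclideanSpace.inner_single_right, PiLp.inner_apply] at h
  simpa [channelMatrix, Matrix.mul_apply, mul_comm] using h

lemma inv_channelMatrix_map (U : CVec M ≃ₗᵢ[ℂ] CVec M) (y : Fin M → CVec M) :
    (channelMatrix fun k => U (y k))⁻¹
      = (Matrix.of fun l m => U (EuclideanSpace.single m 1) l) * (channelMatrix y)⁻¹ := by
  rw [channelMatrix_map, Matrix.mul_inv_rev]
  congr 1
  refine Matrix.inv_eq_left_inv ?_
  ext l m
  rw [Matrix.mul_apply]
  simp only [Matrix.of_apply]
  rw [← isometry_apply_eq_sum U, U.apply_symm_apply]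
  simp [Matrix.one_apply]

/-- Zero-forcing commutes with unitary transformations. -/
lemma zfVector_map (U : CVec M ≃ₗᵢ[ℂ] CVec M) (y : Fin M → CVec M) (j : Fin M) :
    zfVector (fun k => U (y k)) j = U (zfVector y j) := by
  have h : (WithLp.toLp 2 fun m => (channelMatrix fun k => U (y k))⁻¹ m j : CVec M)
      = U (WithLp.toLp 2 fun m => (channelMatrix y)⁻¹ m j) := by
    ext l
    rw [inv_channelMatrix_map, isometry_apply_eq_sum U]
    simp [Matrix.mul_apply]
  simp only [zfVector, h, U.norm_map, map_smul]

/-- The inverse of a singular matrix is zero by convention. All beamforming vectors, and hence all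
rates, then vanish, so almost sure invertibility need not be established. -/
lemma zfVector_eq_zero {y : Fin M → CVec M} (h : ¬ IsUnit (channelMatrix y).det) (j : Fin M) :
    zfVector y j = 0 := by
  have : (WithLp.toLp 2 fun m => (channelMatrix y)⁻¹ m j : CVec M) = 0 := by
    ext m
    simp [Matrix.nonsing_inv_apply_not_isUnit _ h]
  simp [zfVector, this]

lemma inner_inv_channelMatrix {y : Fin M → CVec M} (h : IsUnit (channelMatrix y).det)
    (k j : Fin M) :
    inner ℂ (y k) (WithLp.toLp 2 fun m => (channelMatrix y)⁻¹ m j : CVec M)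
      = if k = j then 1 else 0 := by
  have h1 := congrFun (congrFun (Matrix.mul_nonsing_inv _ h) k) j
  rw [Matrix.mul_apply, Matrix.one_apply] at h1
  rw [← h1, PiLp.inner_apply]
  simp [channelMatrix, mul_comm]

lemma norm_zfVector {y : Fin M → CVec M} (h : IsUnit (channelMatrix y).det) (j : Fin M) :
    ‖zfVector y j‖ = 1 := by
  have hc : (WithLp.toLp 2 fun m => (channelMatrix y)⁻¹ m j : CVec M) ≠ 0 := by
    intro h0
    have := inner_inv_channelMatrix h j j
    simp [h0] at this
  have hc' := norm_ne_zero_iff.2 hc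
  simp only [zfVector, norm_smul, Complex.norm_real, norm_inv, norm_norm]
  exact inv_mul_cancel₀ hc'

/-- A zero-forcing vector is orthogonal to the (estimated) channels of the other users. -/
lemma inner_zfVector (y : Fin M → CVec M) {k j : Fin M} (hkj : k ≠ j) :
    inner ℂ (y k) (zfVector y j) = 0 := by
  by_cases h : IsUnit (channelMatrix y).det
  · simp only [zfVector, inner_smul_right, inner_inv_channelMatrix h, if_neg hkj, mul_zero]
  · rw [zfVector_eq_zero h, inner_zero_right]

lemma norm_zfVector_le_one (y : Fin M → CVec M) (j : Fin M) : ‖zfVector y j‖ ≤ 1 := by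
  by_cases h : IsUnit (channelMatrix y).det
  · exact (norm_zfVector h j).le
  · simp [zfVector_eq_zero h]

/-- The zero-forcing vectors vanish (by convention) all together. -/
lemma zfVector_eq_zero_of_eq_zero {y : Fin M → CVec M} {j : Fin M} (h : zfVector y j = 0)
    (i : Fin M) : zfVector y i = 0 := by
  by_cases hd : IsUnit (channelMatrix y).det
  · have := norm_zfVector hd j
    simp [h] at this
  · exact zfVector_eq_zero hd i

lemma norm_zfVector_of_ne_zero {y : Fin M → CVec M} {j : Fin M} (h : zfVector y j ≠ 0) :
    ‖zfVector y j‖ = 1 :=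
  norm_zfVector (by_contra fun hd => h (zfVector_eq_zero hd j)) j

/-! ### The pointwise bound on the rate -/

/-- The `-log` of the fraction of the part of `h` orthogonal to `a` which is carried by `v`. -/
def interferenceLoss (h a v : CVec M) : ℝ≥0∞ :=
  if v = 0 then 0 else negLog (‖inner ℂ h v‖ ^ 2 / (‖h‖ ^ 2 - ‖inner ℂ h a‖ ^ 2))

lemma measurable_interferenceLoss :
    Measurable fun p : CVec M × CVec M × CVec M => interferenceLoss p.1 p.2.1 p.2.2 := by
  refine Measurable.ite ?_ measurable_const (measurable_negLog.comp (by fun_prop))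
  exact measurableSet_eq_fun (by fun_prop) (by fun_prop)

lemma measurable_interferenceLoss_comp {α : Type*} [MeasurableSpace α] {f g k : α → CVec M}
    (hf : Measurable f) (hg : Measurable g) (hk : Measurable k) :
    Measurable fun x => interferenceLoss (f x) (g x) (k x) :=
  measurable_interferenceLoss.comp (hf.prodMk (hg.prodMk hk))

/-- The quantization error and the interference loss bound the rate, whatever the power. -/
lemma ofReal_log_one_add_sinr_le {P : ℝ} (hP : 0 < P) (h y : Fin M → CVec M) {i j : Fin M}
    (hij : i ≠ j) (hy : ‖y i‖ = 1) :
    ENNReal.ofReal (Real.log (1 + sinr P h (zfVector y) i)) ≤ ENNReal.ofReal (Real.log 2)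
      + (negLog (1 - ‖inner ℂ (h i) (y i)‖ ^ 2 / ‖h i‖ ^ 2)
        + interferenceLoss (h i) (y i) (zfVector y j)) := by
  have hM : (0 : ℝ) < M := by exact_mod_cast i.pos
  have hp : 0 < P / M := div_pos hP hM
  unfold interferenceLoss
  split_ifs with hv
  · rw [sinr, zfVector_eq_zero_of_eq_zero hv i]
    simp
  rcases eq_or_ne (h i) 0 with hh | hh
  · rw [sinr, hh]
    simp
  have hh' : 0 < ‖h i‖ ^ 2 := by positivity
  set X := fun k => ‖inner ℂ (h i) (zfVector y k)‖ ^ 2 with hX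
  have hXle : ∀ k, X k ≤ ‖h i‖ ^ 2 := fun k => by
    have := (norm_inner_le_norm (𝕜 := ℂ) (h i) (zfVector y k)).trans
      (mul_le_of_le_one_right (norm_nonneg _) (norm_zfVector_le_one y k))
    exact pow_le_pow_left₀ (norm_nonneg _) this 2
  have hX0 : ∀ k, 0 ≤ X k := fun k => sq_nonneg _
  set D := ‖h i‖ ^ 2 - ‖inner ℂ (h i) (y i)‖ ^ 2 with hD
  have hD0 : 0 ≤ D := by
    have := norm_inner_le_norm (𝕜 := ℂ) (h i) (y i)
    rw [hy, mul_one] at this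
    exact sub_nonneg.2 (pow_le_pow_left₀ (norm_nonneg _) this 2)
  have hZ : 1 - ‖inner ℂ (h i) (y i)‖ ^ 2 / ‖h i‖ ^ 2 = D / ‖h i‖ ^ 2 := by
    rw [hD, sub_div, div_self hh'.ne']
  rw [hZ]
  -- If `X j` or `D` vanishes, the right-hand side is infinite.
  rcases (hX0 j).eq_or_lt with hXj | hXj
  · have : negLog (X j / D) = ⊤ := by rw [← hXj, zero_div]; simp [negLog]
    rw [show ‖inner ℂ (h i) (zfVector y j)‖ ^ 2 = X j from rfl, this]
    simp
  rcases hD0.eq_or_lt with hDz | hDz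
  · rw [← hDz, zero_div]
    simp [negLog]
  -- The two losses combine: `D` cancels in the product of their arguments, leaving `X j / ‖h i‖ ^
  -- 2`.
  refine le_trans ?_ (add_le_add le_rfl negLog_mul_le)
  rw [show ‖inner ℂ (h i) (zfVector y j)‖ ^ 2 = X j from rfl,
    show D / ‖h i‖ ^ 2 * (X j / D) = X j / ‖h i‖ ^ 2 by field_simp,
    negLog_of_pos (div_pos hXj hh'), ← ENNReal.ofReal_add (Real.log_nonneg one_le_two) ?_]
  · refine ENNReal.ofReal_le_ofReal ?_
    rw [← sub_eq_add_neg, ← Real.log_div two_ne_zero (div_pos hXj hh').ne']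
    -- Dropping the noise and every interferer but `j` makes the power cancel.
    have hs : sinr P h (zfVector y) i ≤ X i / X j := by
      rw [sinr]
      have hsum : P / M * X j ≤ ∑ k ∈ Finset.univ.erase i, P / M * X k :=
        Finset.single_le_sum (f := fun k => P / M * X k)
          (fun k _ => mul_nonneg hp.le (hX0 k)) (by simp [hij.symm])
      have h1 : 0 < P / M * X j := mul_pos hp hXj
      calc P / M * X i / (1 + ∑ k ∈ Finset.univ.erase i, P / M * X k)
          ≤ P / M * X i / (P / M * X j) :=
            div_le_div_of_nonneg_left (mul_nonneg hp.le (hX0 i)) h1 (by linarith)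
        _ = X i / X j := mul_div_mul_left _ _ hp.ne'
    have hs0 : 0 ≤ sinr P h (zfVector y) i :=
      div_nonneg (mul_nonneg hp.le (hX0 i)) (add_nonneg zero_le_one
        (Finset.sum_nonneg fun k _ => mul_nonneg hp.le (hX0 k)))
    refine Real.log_le_log (by linarith) ?_
    calc 1 + sinr P h (zfVector y) i ≤ 1 + X i / X j := by linarith
      _ = (X j + X i) / X j := by field_simp
      _ ≤ (2 * ‖h i‖ ^ 2) / X j := by
        gcongr
        linarith [hXle i, hXle j]
      _ = 2 / (X j / ‖h i‖ ^ 2) := by field_simp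
  · rw [neg_nonneg]
    exact Real.log_nonpos (div_pos hXj hh').le ((div_le_one hh').2 (hXle j))

/-! ### Averaging over isotropic directions -/

lemma exists_isometry_of_norm_eq_one {a b : CVec M} (ha : ‖a‖ = 1) (hb : ‖b‖ = 1) :
    ∃ U : CVec M ≃ₗᵢ[ℂ] CVec M, U a = b := by
  have hM : 0 < M := by
    rcases Nat.eq_zero_or_pos M with rfl | h
    · rw [Subsingleton.elim a 0] at ha; simp at ha
    · exact h
  obtain ⟨U, hU⟩ := exists_isometry_single ⟨0, hM⟩ ha
  obtain ⟨V, hV⟩ := exists_isometry_single ⟨0, hM⟩ hb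
  refine ⟨U.trans V.symm, ?_⟩
  rw [LinearIsometryEquiv.trans_apply, hU, ← hV, V.symm_apply_apply]

/-- The stabilizer of `a` is transitive on unit vectors orthogonal to `a`: send both pairs to the
same two basis vectors. -/
lemma exists_isometry_fixing (hM : 2 ≤ M) {a b c : CVec M} (ha : ‖a‖ = 1) (hb : ‖b‖ = 1)
    (hc : ‖c‖ = 1) (hab : inner ℂ a b = 0) (hac : inner ℂ a c = 0) :
    ∃ U : CVec M ≃ₗᵢ[ℂ] CVec M, U a = a ∧ U b = c := by
  have hij : (⟨0, by omega⟩ : Fin M) ≠ ⟨1, by omega⟩ := by simp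
  obtain ⟨U, hUa, hUb⟩ := exists_isometry_pair_single hij ha hb hab
  obtain ⟨V, hVa, hVc⟩ := exists_isometry_pair_single hij ha hc hac
  refine ⟨U.trans V.symm, ?_, ?_⟩
  · rw [LinearIsometryEquiv.trans_apply, hUa, ← hVa, V.symm_apply_apply]
  · rw [LinearIsometryEquiv.trans_apply, hUb, ← hVc, V.symm_apply_apply]

lemma norm_inner_map_of_map_normalize {U : CVec M ≃ₗᵢ[ℂ] CVec M} {h g : CVec M} (hg : g ≠ 0)
    (hU : U ((‖h‖⁻¹ : ℂ) • h) = (‖g‖⁻¹ : ℂ) • g) (x : CVec M) :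
    ‖inner ℂ g (U x)‖ = ‖g‖ / ‖h‖ * ‖inner ℂ h x‖ := by
  have hg' : ‖g‖ ≠ 0 := norm_ne_zero_iff.2 hg
  have h1 : inner ℂ ((‖g‖⁻¹ : ℂ) • g) (U x) = inner ℂ ((‖h‖⁻¹ : ℂ) • h) x := by
    rw [← hU, U.inner_map_map]
  have h2 := congrArg norm h1
  simp only [inner_smul_left, norm_mul, RCLike.norm_conj, norm_inv, Complex.norm_real,
    norm_norm] at h2
  rw [div_mul_eq_mul_div, mul_div_assoc, div_eq_inv_mul, ← h2]
  field_simp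

lemma gaussianVec_ae_ne_zero (hM : 2 ≤ M) : ∀ᵐ g ∂gaussianVec M, g ≠ 0 := by
  refine measure_mono_null (fun g hg => ?_) (gaussianVec_norm_inner_sq_eq hM
    (a := EuclideanSpace.single ⟨0, by omega⟩ 1) (by simp) 0)
  have : g = 0 := by simpa using hg
  simp [this]

/-- If `x` is isotropic, then the law of `|⟨h, x⟩|` has no atoms. -/
lemma isotropic_norm_inner_sq_eq (hM : 2 ≤ M) {ν : Measure (CVec M)}
    (hν : IsIsotropicOnSphere ν) {h : CVec M} (hh : h ≠ 0) (t : ℝ) :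
    ν {x | ‖inner ℂ h x‖ ^ 2 = t} = 0 := by
  have := hν.prob
  have hh' : ‖h‖ ≠ 0 := norm_ne_zero_iff.2 hh
  set ρ := t / ‖h‖ ^ 2 with hρ
  have ht : t = ρ * ‖h‖ ^ 2 := by rw [hρ]; field_simp
  have hS : MeasurableSet {p : CVec M × CVec M | ‖inner ℂ p.2 p.1‖ ^ 2 = ρ * ‖p.2‖ ^ 2} := measurableSet_eq_fun (by fun_prop) (by fun_prop)
  have hsec : ∀ g : CVec M, MeasurableSet {x | ‖inner ℂ g x‖ ^ 2 = ρ * ‖g‖ ^ 2} := fun g =>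
    measurableSet_eq_fun (by fun_prop) measurable_const
  -- By unitary invariance this probability is the same for all nonzero `g`. Fubini against a
  -- Gaussian `g` shows that it is zero for some `g`, hence for `h`.
  have hconst : ∀ g : CVec M, g ≠ 0 → ν {x | ‖inner ℂ g x‖ ^ 2 = ρ * ‖g‖ ^ 2}
      = ν {x | ‖inner ℂ h x‖ ^ 2 = ρ * ‖h‖ ^ 2} := by
    intro g hg
    have hg' : ‖g‖ ≠ 0 := norm_ne_zero_iff.2 hg
    obtain ⟨U, hU⟩ := exists_isometry_of_norm_eq_one (norm_smul_inv_norm (𝕜 := ℂ) hh)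
      (norm_smul_inv_norm (𝕜 := ℂ) hg)
    conv_lhs => rw [← hν.invariant U]
    rw [Measure.map_apply U.continuous.measurable (hsec g)]
    congr 1
    ext x
    have hinner := norm_inner_map_of_map_normalize hg hU x
    simp only [Set.mem_preimage, Set.mem_ofPred_eq, hinner]
    rw [mul_pow, div_pow, div_mul_eq_mul_div, div_eq_iff (by positivity)]
    constructor
    · intro h1
      have : ‖g‖ ^ 2 * ‖inner ℂ h x‖ ^ 2 = ‖g‖ ^ 2 * (ρ * ‖h‖ ^ 2) := by linarith
      exact mul_left_cancel₀ (by positivity) this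
    · intro h1
      rw [h1]; ring
  have hae : ∀ᵐ x ∂ν, ∀ᵐ g ∂gaussianVec M, ¬ ‖inner ℂ g x‖ ^ 2 = ρ * ‖g‖ ^ 2 := by
    filter_upwards [hν.norm_eq_one] with x hx
    rw [ae_iff]
    simpa using gaussianVec_norm_inner_sq_eq hM hx ρ
  rw [Measure.ae_ae_comm hS.compl] at hae
  obtain ⟨g, hg, hg0⟩ := (hae.and (gaussianVec_ae_ne_zero hM)).exists
  rw [ht, ← hconst g hg0]
  simpa [ae_iff] using hg

/-- Averaged over the other users' (isotropic) quantization vectors, the interference loss does not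
depend on the direction of the quantization error, and can be computed for a Gaussian channel. -/
lemma lintegral_interferenceLoss_le (hM : 2 ≤ M) (ξ : Measure (Fin M → CVec M))
    [IsProbabilityMeasure ξ]
    (hξ : ∀ U : CVec M ≃ₗᵢ[ℂ] CVec M, ξ.map (fun x k => U (x k)) = ξ) {i j : Fin M}
    (hij : i ≠ j) {a h : CVec M} (ha : ‖a‖ = 1) (hh : ‖inner ℂ h a‖ ^ 2 ≠ ‖h‖ ^ 2) :
    ∫⁻ x, interferenceLoss h a (zfVector (Function.update x i a) j) ∂ξ
      ≤ ENNReal.ofReal (betaBound M) := by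
  have hmz : Measurable fun x : Fin M → CVec M => zfVector (Function.update x i a) j :=
    (measurable_zfVector j).comp
      ((measurable_update_prod (α := fun _ : Fin M => CVec M) i).comp measurable_prodMk_left)
  have hperp : ∀ x : Fin M → CVec M, inner ℂ a (zfVector (Function.update x i a) j) = 0 :=
    fun x => by simpa using inner_zfVector (Function.update x i a) hij
  -- `s g` is the component of `g` orthogonal to `a`; the loss depends on `g` only through it, as
  -- the zero-forcing vector is orthogonal to `a`.
  let s : CVec M → CVec M := fun g => g - inner ℂ a g • a
  have hs_perp : ∀ g, inner ℂ a (s g) = 0 := fun g => by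
    simp [s, inner_self_eq_norm_sq_to_K, ha]
  have hs_inner : ∀ g v, inner ℂ a v = 0 → inner ℂ g v = inner ℂ (s g) v := fun g v hv => by
    simp [s, hv]
  have hs_norm : ∀ g, ‖g‖ ^ 2 - ‖inner ℂ g a‖ ^ 2 = ‖s g‖ ^ 2 := fun g => by
    have h1 : g = s g + inner ℂ a g • a := by simp [s]
    have h2 : inner ℂ (s g) (inner ℂ a g • a) = 0 := by
      rw [inner_smul_right, inner_eq_zero_symm.1 (hs_perp g), mul_zero]
    have h3 := norm_add_sq_eq_norm_sq_add_norm_sq_of_inner_eq_zero _ _ h2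
    rw [← h1, norm_smul, ha, norm_inner_symm] at h3
    rw [pow_two, h3]; ring
  -- A unitary map fixing `a` and carrying the direction of `s h` to that of `s g` preserves `ξ` and
  -- commutes with zero-forcing, so both channels have the same mean loss.
  have hconst : ∀ g : CVec M, ‖inner ℂ g a‖ ^ 2 ≠ ‖g‖ ^ 2 →
      ∫⁻ x, interferenceLoss g a (zfVector (Function.update x i a) j) ∂ξ
        = ∫⁻ x, interferenceLoss h a (zfVector (Function.update x i a) j) ∂ξ := by
    intro g hg
    have hsg : s g ≠ 0 := fun h0 => hg (by
      have := hs_norm g; rw [h0] at this; simp at this; linarith)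
    have hsh : s h ≠ 0 := fun h0 => hh (by
      have := hs_norm h; rw [h0] at this; simp at this; linarith)
    have hsg' : ‖s g‖ ≠ 0 := norm_ne_zero_iff.2 hsg
    have hsh' : ‖s h‖ ≠ 0 := norm_ne_zero_iff.2 hsh
    obtain ⟨U, hUa, hU⟩ := exists_isometry_fixing hM ha (norm_smul_inv_norm (𝕜 := ℂ) hsh)
      (norm_smul_inv_norm (𝕜 := ℂ) hsg) (by rw [inner_smul_right, hs_perp, mul_zero])
      (by rw [inner_smul_right, hs_perp, mul_zero])
    have hmU : Measurable fun (x : Fin M → CVec M) k => U (x k) :=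
      measurable_pi_lambda _ fun k => U.continuous.measurable.comp (measurable_pi_apply k)
    conv_lhs => rw [← hξ U]
    rw [lintegral_map (measurable_interferenceLoss_comp measurable_const measurable_const hmz) hmU]
    refine lintegral_congr fun x => ?_
    have hup : Function.update (fun k => U (x k)) i a
        = fun k => U (Function.update x i a k) := by
      ext1 k
      by_cases hk : k = i
      · subst hk; simp [hUa]
      · simp [Function.update_of_ne hk]
    rw [hup, zfVector_map]
    set v := zfVector (Function.update x i a) j with hv
    have hav : inner ℂ a v = 0 := hperp x
    have haUv : inner ℂ a (U v) = 0 := by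
      rw [← hUa, U.inner_map_map, hav]
    have hinner : ‖inner ℂ g (U v)‖ = ‖s g‖ / ‖s h‖ * ‖inner ℂ h v‖ := by
      rw [hs_inner g _ haUv, hs_inner h _ hav, norm_inner_map_of_map_normalize hsg hU]
    unfold interferenceLoss
    have hz : U v = 0 ↔ v = 0 := by simp
    simp only [hz, hinner, hs_norm]
    congr 2
    field_simp
  have hae : ∀ᵐ g ∂gaussianVec M, ‖inner ℂ g a‖ ^ 2 ≠ ‖g‖ ^ 2 := by
    have := gaussianVec_norm_inner_sq_eq hM ha 1
    rw [ae_iff]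
    simpa using this
  have hm : Measurable fun p : CVec M × (Fin M → CVec M) =>
      interferenceLoss p.1 a (zfVector (Function.update p.2 i a) j) :=
    measurable_interferenceLoss_comp measurable_fst measurable_const (hmz.comp measurable_snd)
  -- Being independent of the channel, the mean can be averaged over a Gaussian `g`; after
  -- exchanging the integrals the beamforming vector is fixed and the Gaussian estimate applies.
  calc ∫⁻ x, interferenceLoss h a (zfVector (Function.update x i a) j) ∂ξ
      = ∫⁻ _, ∫⁻ x, interferenceLoss h a (zfVector (Function.update x i a) j) ∂ξ
          ∂gaussianVec M := by simp
    _ = ∫⁻ g, ∫⁻ x, interferenceLoss g a (zfVector (Function.update x i a) j) ∂ξ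
          ∂gaussianVec M := by
        refine lintegral_congr_ae ?_
        filter_upwards [hae] with g hg
        exact (hconst g hg).symm
    _ = ∫⁻ x, ∫⁻ g, interferenceLoss g a (zfVector (Function.update x i a) j) ∂gaussianVec M
          ∂ξ := lintegral_lintegral_swap hm.aemeasurable
    _ ≤ ∫⁻ _, ENNReal.ofReal (betaBound M) ∂ξ := by
        refine lintegral_mono fun x => ?_
        by_cases hv : zfVector (Function.update x i a) j = 0
        · simp [interferenceLoss, hv]
        · simp only [interferenceLoss, hv, if_false]
          exact lintegral_gaussianVec_negLog_le hM ha (norm_zfVector_of_ne_zero hv) (hperp x)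
    _ = ENNReal.ofReal (betaBound M) := by simp

end Vectors

/-! ### Quantization of the channel and the two mean losses -/

section Quantization

variable {M : ℕ} {K : Type*}

/-- The index `k` maximizes `|h† w_k|`, where `d = (h, w)` is a channel and a codebook. -/
def IsBest (d : CVec M × (K → CVec M)) (k : K) : Prop :=
  ∀ l, ‖inner ℂ d.1 (d.2 l)‖ ≤ ‖inner ℂ d.1 (d.2 k)‖

open scoped Classical in
lemma filter_isBest_nonempty [Fintype K] [Nonempty K] (d : CVec M × (K → CVec M)) :
    (Finset.univ.filter (IsBest d)).Nonempty := by
  obtain ⟨k, -, hk⟩ := Finset.exists_max_image Finset.univ (fun k => ‖inner ℂ d.1 (d.2 k)‖)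
    Finset.univ_nonempty
  exact ⟨k, by simpa [IsBest] using hk⟩

open scoped Classical in
/-- The first index maximizing `|h† w_k|`. -/
def bestIndex [Fintype K] [LinearOrder K] [Nonempty K] (d : CVec M × (K → CVec M)) : K :=
  (Finset.univ.filter (IsBest d)).min' (filter_isBest_nonempty d)

/-- The quantized channel when ties are broken by taking the first maximizer. -/
def quantized [Fintype K] [LinearOrder K] [Nonempty K] (d : CVec M × (K → CVec M)) :
    CVec M := d.2 (bestIndex d)

lemma measurableSet_isBest [Fintype K] (k : K) :
    MeasurableSet {d : CVec M × (K → CVec M) | IsBest d k} := by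
  simp only [IsBest, Set.ofPred_forall]
  exact MeasurableSet.iInter fun l => measurableSet_le (by fun_prop) (by fun_prop)

lemma isBest_bestIndex [Fintype K] [LinearOrder K] [Nonempty K] (d : CVec M × (K → CVec M)) :
    IsBest d (bestIndex d) := by
  classical
  exact (Finset.mem_filter.1 (Finset.min'_mem _ (filter_isBest_nonempty d))).2

lemma bestIndex_eq_iff [Fintype K] [LinearOrder K] [Nonempty K] (d : CVec M × (K → CVec M))
    (k : K) :
    bestIndex d = k ↔ IsBest d k ∧ ∀ l, l < k → ¬ IsBest d l := by
  classical
  have hle : ∀ l, IsBest d l → bestIndex d ≤ l := fun l hl =>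
    Finset.min'_le _ _ (by simpa using hl)
  constructor
  · rintro rfl
    exact ⟨isBest_bestIndex d, fun l hl h => (hle l h).not_gt hl⟩
  · rintro ⟨h1, h2⟩
    exact le_antisymm (hle k h1) (not_lt.1 fun h => h2 _ h (isBest_bestIndex d))

lemma measurable_quantized [Fintype K] [LinearOrder K] [Nonempty K] :
    Measurable (quantized : CVec M × (K → CVec M) → CVec M) := by
  classical
  have hS : ∀ k, MeasurableSet {d : CVec M × (K → CVec M) | bestIndex d = k} := fun k => by
    simp only [bestIndex_eq_iff, Set.ofPred_and, Set.ofPred_forall]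
    exact (measurableSet_isBest k).inter (MeasurableSet.iInter fun l =>
      MeasurableSet.iInter fun _ => (measurableSet_isBest l).compl)
  have h : (quantized : CVec M × (K → CVec M) → CVec M)
      = fun d => ∑ k, if bestIndex d = k then d.2 k else 0 := by
    ext1 d
    simp [quantized]
  rw [h]
  exact Finset.measurable_fun_sum _ fun k _ => Measurable.ite (hS k) (by fun_prop) measurable_const

/-- A unitary map preserves all the inner products being compared, hence the selected index. -/
lemma quantized_map [Fintype K] [LinearOrder K] [Nonempty K] (U : CVec M ≃ₗᵢ[ℂ] CVec M)
    (d : CVec M × (K → CVec M)) :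
    quantized (U d.1, fun k => U (d.2 k)) = U (quantized d) := by
  have h : bestIndex (U d.1, fun k => U (d.2 k)) = bestIndex d := by
    have hb : ∀ k, IsBest (U d.1, fun k => U (d.2 k)) k ↔ IsBest d k := fun k => by
      simp [IsBest, U.inner_map_map]
    rw [bestIndex_eq_iff]
    simp only [hb]
    exact (bestIndex_eq_iff d _).1 rfl
  rw [quantized, h, quantized]

/-- The joint law of the channel and of the codebook of a user. -/
def userLaw [Fintype K] (ν : K → Measure (CVec M)) : Measure (CVec M × (K → CVec M)) :=
  (gaussianVec M).prod (Measure.pi ν)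

variable {ν : K → Measure (CVec M)}

lemma isProbabilityMeasure_userLaw [Fintype K] (hν : ∀ k, IsIsotropicOnSphere (ν k)) :
    IsProbabilityMeasure (userLaw ν) := by
  have := fun k => (hν k).prob
  unfold userLaw
  infer_instance

lemma measurable_map_user (U : CVec M ≃ₗᵢ[ℂ] CVec M) :
    Measurable fun d : CVec M × (K → CVec M) => (U d.1, fun k => U (d.2 k)) := by
  have := U.continuous.measurable
  fun_prop

lemma userLaw_map [Fintype K] (hν : ∀ k, IsIsotropicOnSphere (ν k)) (U : CVec M ≃ₗᵢ[ℂ] CVec M) :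
    (userLaw ν).map (fun d => (U d.1, fun k => U (d.2 k))) = userLaw ν := by
  have := fun k => (hν k).prob
  have hU : Measurable U := U.continuous.measurable
  have h1 : (Measure.pi ν).map (fun w k => U (w k)) = Measure.pi ν := by
    have : ∀ k, SigmaFinite ((ν k).map U) := fun k => by
      rw [(hν k).invariant]; infer_instance
    rw [Measure.pi_map_pi fun k => hU.aemeasurable]
    congr 1
    ext1 k
    exact (hν k).invariant U
  have h2 := Measure.map_prod_map (gaussianVec M) (Measure.pi ν) hU
    (g := fun w k => U (w k)) (by fun_prop)
  rw [gaussianVec_map, h1] at h2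
  exact h2.symm

lemma ae_userLaw_norm_eq_one [Fintype K] (hν : ∀ k, IsIsotropicOnSphere (ν k)) :
    ∀ᵐ d ∂userLaw ν, ∀ k, ‖d.2 k‖ = 1 := by
  have := fun k => (hν k).prob
  rw [ae_all_iff]
  intro k
  have h : Measure.QuasiMeasurePreserving (fun d : CVec M × (K → CVec M) => d.2 k)
      (userLaw ν) (ν k) :=
    (Measure.quasiMeasurePreserving_eval ν k).comp Measure.quasiMeasurePreserving_snd
  exact h.ae (hν k).norm_eq_one

/-- The law of the pair formed by the channel and one vector of the codebook. -/
lemma userLaw_map_pair [Fintype K] (hν : ∀ k, IsIsotropicOnSphere (ν k)) (k : K) :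
    (userLaw ν).map (fun d => (d.1, d.2 k)) = (gaussianVec M).prod (ν k) := by
  have := fun k => (hν k).prob
  have h := Measure.map_prod_map (gaussianVec M) (Measure.pi ν) measurable_id
    (measurable_pi_apply k)
  rw [Measure.map_id, (measurePreserving_eval ν k).map_eq] at h
  exact h.symm

/-- The quantization error is almost surely nonzero, so the direction of the part of the channel
orthogonal to the quantized vector is defined. -/
lemma ae_userLaw_norm_inner_ne [Fintype K] (hM : 2 ≤ M) (hν : ∀ k, IsIsotropicOnSphere (ν k)) :
    ∀ᵐ d ∂userLaw ν, ∀ k, ‖inner ℂ d.1 (d.2 k)‖ ^ 2 ≠ ‖d.1‖ ^ 2 := by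
  have := fun k => (hν k).prob
  rw [ae_all_iff]
  intro k
  have hS : MeasurableSet {p : CVec M × CVec M | ‖inner ℂ p.1 p.2‖ ^ 2 ≠ ‖p.1‖ ^ 2} :=
    (measurableSet_eq_fun (by fun_prop) (by fun_prop)).compl
  have h : ∀ᵐ p ∂(gaussianVec M).prod (ν k), ‖inner ℂ p.1 p.2‖ ^ 2 ≠ ‖p.1‖ ^ 2 := by
    rw [Measure.ae_prod_iff_ae_ae hS, Measure.ae_ae_comm hS]
    filter_upwards [(hν k).norm_eq_one] with x hx
    rw [ae_iff]
    simpa using gaussianVec_norm_inner_sq_eq hM hx 1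
  rw [← userLaw_map_pair hν k, ae_map_iff (by fun_prop) hS] at h
  exact h

/-- Almost surely, there are no ties between the vectors of a codebook. -/
lemma ae_userLaw_injective [Fintype K] (hM : 2 ≤ M) (hν : ∀ k, IsIsotropicOnSphere (ν k)) :
    ∀ᵐ d ∂userLaw ν, ∀ k l, k ≠ l → ‖inner ℂ d.1 (d.2 k)‖ ≠ ‖inner ℂ d.1 (d.2 l)‖ := by
  classical
  have := fun k => (hν k).prob
  simp only [ae_all_iff]
  intro k l hkl
  have hS : MeasurableSet {d : CVec M × (K → CVec M) |
      ‖inner ℂ d.1 (d.2 k)‖ ≠ ‖inner ℂ d.1 (d.2 l)‖} :=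
    (measurableSet_eq_fun (by fun_prop) (by fun_prop)).compl
  rw [userLaw, Measure.ae_prod_iff_ae_ae hS]
  filter_upwards [gaussianVec_ae_ne_zero hM] with g hg
  have hT : MeasurableSet {w : K → CVec M | ‖inner ℂ g (w k)‖ = ‖inner ℂ g (w l)‖} :=
    measurableSet_eq_fun (by fun_prop) (by fun_prop)
  rw [ae_iff]
  simp only [ne_eq, not_not]
  -- Resample the `l`-th vector: with the `k`-th fixed, a tie asks a law without atoms to hit a
  -- given value.
  rw [← lintegral_indicator_one hT, lintegral_pi_update ν l (measurable_one.indicator hT),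
    lintegral_lintegral_swap (by
      exact ((measurable_one.indicator hT).comp (measurable_update_prod l)).aemeasurable)]
  refine (lintegral_congr fun w => ?_).trans (lintegral_zero (μ := Measure.pi ν))
  rw [← isotropic_norm_inner_sq_eq hM (hν l) hg (‖inner ℂ g (w k)‖ ^ 2),
    ← lintegral_indicator_one (measurableSet_eq_fun (by fun_prop) measurable_const)]
  refine lintegral_congr fun x => ?_
  have hiff : ‖inner ℂ g (w k)‖ = ‖inner ℂ g x‖
      ↔ ‖inner ℂ g x‖ ^ 2 = ‖inner ℂ g (w k)‖ ^ 2 := by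
    rw [pow_left_inj₀ (norm_nonneg _) (norm_nonneg _) two_ne_zero, eq_comm]
  simp only [Set.indicator, Set.mem_ofPred_eq, Function.update_self, Function.update_of_ne hkl,
    hiff]
  rfl

/-- The tail of the quantization error for one vector of the codebook. -/
lemma userLaw_one_sub_lt_le [Fintype K] (hν : ∀ k, IsIsotropicOnSphere (ν k)) (k : K) {x : ℝ}
    (hx0 : 0 < x) (hx1 : x < 1) :
    userLaw ν {d | 1 - ‖inner ℂ d.1 (d.2 k)‖ ^ 2 / ‖d.1‖ ^ 2 < x}
      ≤ ENNReal.ofReal (x ^ (M - 1)) := by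
  have := fun k => (hν k).prob
  have hS : MeasurableSet {p : CVec M × CVec M |
      1 - ‖inner ℂ p.1 p.2‖ ^ 2 / ‖p.1‖ ^ 2 < x} :=
    measurableSet_lt (by fun_prop) measurable_const
  have h1 : userLaw ν {d | 1 - ‖inner ℂ d.1 (d.2 k)‖ ^ 2 / ‖d.1‖ ^ 2 < x}
      = (gaussianVec M).prod (ν k) {p | 1 - ‖inner ℂ p.1 p.2‖ ^ 2 / ‖p.1‖ ^ 2 < x} := by
    rw [← userLaw_map_pair hν k, Measure.map_apply (by fun_prop) hS, Set.preimage_ofPred_eq]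
  rw [h1, Measure.prod_apply_symm hS]
  refine (lintegral_mono_ae (g := fun _ => ENNReal.ofReal (x ^ (M - 1))) ?_).trans_eq (by simp)
  filter_upwards [(hν k).norm_eq_one] with a ha
  rw [Set.preimage_ofPred_eq]
  exact gaussianVec_one_sub_le ha hx0 hx1

/-- The mean logarithmic loss due to the quantization error. -/
lemma lintegral_negLog_quantized_le [Fintype K] [LinearOrder K] [Nonempty K] (hM : 2 ≤ M)
    (hν : ∀ k, IsIsotropicOnSphere (ν k)) :
    ∫⁻ d, negLog (1 - ‖inner ℂ d.1 (quantized d)‖ ^ 2 / ‖d.1‖ ^ 2) ∂userLaw ν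
      ≤ ENNReal.ofReal ((Real.log (Fintype.card K) + 1) / (M - 1)) := by
  have := isProbabilityMeasure_userLaw hν
  have hq := measurable_quantized (M := M) (K := K)
  have hK : (1 : ℝ) ≤ Fintype.card K := by exact_mod_cast Fintype.card_pos
  have hX : Measurable fun d : CVec M × (K → CVec M) =>
      1 - ‖inner ℂ d.1 (quantized d)‖ ^ 2 / ‖d.1‖ ^ 2 := by fun_prop
  have htail : ∀ x : ℝ, 0 < x → x < 1 →
      userLaw ν {d | 1 - ‖inner ℂ d.1 (quantized d)‖ ^ 2 / ‖d.1‖ ^ 2 < x}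
        ≤ ENNReal.ofReal (Fintype.card K * x ^ (M - 1)) := by
    intro x hx0 hx1
    -- Union bound over the codebook: this is the source of the factor `Fintype.card K`.
    have hsub : {d : CVec M × (K → CVec M) |
        1 - ‖inner ℂ d.1 (quantized d)‖ ^ 2 / ‖d.1‖ ^ 2 < x}
        ⊆ ⋃ k, {d | 1 - ‖inner ℂ d.1 (d.2 k)‖ ^ 2 / ‖d.1‖ ^ 2 < x} := by
      intro d hd
      rw [Set.mem_iUnion]
      refine ⟨bestIndex d, ?_⟩
      rw [Set.mem_ofPred_eq] at hd ⊢
      rwa [quantized] at hd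
    refine (measure_mono hsub).trans ((measure_iUnion_fintype_le _ _).trans ?_)
    refine (Finset.sum_le_sum fun k _ => userLaw_one_sub_lt_le hν k hx0 hx1).trans_eq ?_
    rw [Finset.sum_const, Finset.card_univ, nsmul_eq_mul, ENNReal.ofReal_mul (by positivity),
      ENNReal.ofReal_natCast]
  have h := lintegral_negLog_le (userLaw ν) hX.aemeasurable hK (by omega) htail
  rwa [Nat.cast_sub (by omega), Nat.cast_one] at h

/-- The mean logarithmic loss due to the misalignment of the interference. -/
lemma lintegral_pi_interferenceLoss_le [Fintype K] [LinearOrder K] [Nonempty K] (hM : 2 ≤ M)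
    {ν : Fin M → K → Measure (CVec M)}
    (hν : ∀ i k, IsIsotropicOnSphere (ν i k)) {i j : Fin M} (hij : i ≠ j) :
    ∫⁻ x, interferenceLoss (x i).1 (quantized (x i)) (zfVector (fun k => quantized (x k)) j)
        ∂Measure.pi (fun i => userLaw (ν i)) ≤ ENNReal.ofReal (betaBound M) := by
  have hp := fun i => isProbabilityMeasure_userLaw (hν i)
  have hq := measurable_quantized (M := M) (K := K)
  have hqq : Measurable fun (x : Fin M → CVec M × (K → CVec M)) k => quantized (x k) := by
    fun_prop
  have hz := (measurable_zfVector j).comp hqq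
  have hz' : Measurable fun x : Fin M → CVec M × (K → CVec M) =>
      zfVector (fun k => quantized (x k)) j := hz
  have hm : Measurable fun x : Fin M → CVec M × (K → CVec M) =>
      interferenceLoss (x i).1 (quantized (x i)) (zfVector (fun k => quantized (x k)) j) :=
    measurable_interferenceLoss_comp (by fun_prop) (by fun_prop) hz'
  set ξ := (Measure.pi fun i => userLaw (ν i)).map (fun x k => quantized (x k)) with hξ_def
  have : IsProbabilityMeasure ξ := Measure.isProbabilityMeasure_map hqq.aemeasurable
  -- Rotating channels and codebooks together preserves their law, and quantization commutes with
  -- the rotation.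
  have hξ : ∀ U : CVec M ≃ₗᵢ[ℂ] CVec M, ξ.map (fun x k => U (x k)) = ξ := by
    intro U
    have hU : Measurable U := U.continuous.measurable
    have h1 : (Measure.pi fun i => userLaw (ν i)).map
        (fun x i => (U (x i).1, fun k => U ((x i).2 k))) = Measure.pi fun i => userLaw (ν i) := by
      have : ∀ i, SigmaFinite ((userLaw (ν i)).map fun d => (U d.1, fun k => U (d.2 k))) :=
        fun i => by rw [userLaw_map (hν i)]; infer_instance
      have h := Measure.pi_map_pi (μ := fun i => userLaw (ν i))
        (f := fun _ d => (U d.1, fun k => U (d.2 k)))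
        fun i => (measurable_map_user U).aemeasurable
      rw [h]
      congr 1
      ext1 i
      exact userLaw_map (hν i) U
    conv_rhs => rw [hξ_def, ← h1]
    rw [Measure.map_map hqq (by fun_prop), hξ_def, Measure.map_map (by fun_prop) hqq]
    congr 1
    ext1 x
    funext k
    exact (quantized_map U (x k)).symm
  -- Condition on the channel and codebook `c` of user `i`: the other users stay random and
  -- independent of `c`.
  rw [lintegral_pi_update (fun i => userLaw (ν i)) i hm]
  calc _ ≤ ∫⁻ _, ENNReal.ofReal (betaBound M) ∂userLaw (ν i) := by
        refine lintegral_mono_ae ?_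
        filter_upwards [ae_userLaw_norm_eq_one (hν i), ae_userLaw_norm_inner_ne hM (hν i)]
          with c hc1 hc2
        have h := lintegral_interferenceLoss_le hM ξ hξ hij (hc1 (bestIndex c))
          (hc2 (bestIndex c))
        rw [hξ_def, lintegral_map ?_ hqq] at h
        · refine le_trans (le_of_eq (lintegral_congr fun x => ?_)) h
          have hup : (fun k => quantized (Function.update x i c k))
              = Function.update (fun k => quantized (x k)) i (c.2 (bestIndex c)) := by
            ext1 k
            by_cases hk : k = i
            · subst hk; simp [quantized]
            · simp [Function.update_of_ne hk]
          rw [hup, Function.update_self]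
          rfl
        · exact measurable_interferenceLoss_comp measurable_const measurable_const
            ((measurable_zfVector j).comp ((measurable_update_prod
              (α := fun _ : Fin M => CVec M) i).comp measurable_prodMk_left))
    _ = _ := by simp

end Quantization

/-! ### From the model to product laws, and the rate bounds -/

section Model

variable {M B : ℕ} {Ω : Type*} [MeasurableSpace Ω] {μ : Measure Ω} {h : Fin M → Ω → CVec M}
  {w : Fin M → Fin (2 ^ B) → Ω → CVec M} {F : Fin M → Ω → Fin (2 ^ B)}

lemma pi_map_curry {ι κ X : Type*} [Fintype ι] [Fintype κ] [MeasurableSpace X]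
    (ν : ι → κ → Measure X) [∀ i k, IsProbabilityMeasure (ν i k)] :
    (Measure.pi fun p : ι × κ => ν p.1 p.2).map (fun x i k => x (i, k))
      = Measure.pi fun i => Measure.pi (ν i) := by
  have h := Measure.infinitePi_map_curry ν
  simp only [Measure.infinitePi_eq_pi] at h
  exact h

lemma IsModel.hasLaw_channels [IsProbabilityMeasure μ] (hm : IsModel μ h w F) :
    HasLaw (fun ω i => h i ω) (Measure.pi fun _ : Fin M => gaussianVec M) μ := by
  have hmeas : ∀ p : Fin M × Fin M, AEMeasurable (fun ω => h p.1 ω p.2) μ := fun p =>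
    (hm.channel_law p.1 p.2).aemeasurable
  have hlaw := (iIndepFun_iff_map_fun_eq_pi_map hmeas).1 hm.channel_indep
  simp only [fun p : Fin M × Fin M => (hm.channel_law p.1 p.2).map_eq] at hlaw
  have hpair : AEMeasurable (fun ω (p : Fin M × Fin M) => h p.1 ω p.2) μ :=
    aemeasurable_pi_lambda _ hmeas
  have hcurry : Measurable fun (x : Fin M × Fin M → ℂ) i k => x (i, k) := by fun_prop
  have hlp : Measurable fun (x : Fin M → Fin M → ℂ) i => (WithLp.toLp 2 (x i) : CVec M) := by
    fun_prop
  have heq : (fun ω i => h i ω) = (fun (x : Fin M → Fin M → ℂ) i => (WithLp.toLp 2 (x i) : CVec M))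
      ∘ (fun (x : Fin M × Fin M → ℂ) i k => x (i, k)) ∘ (fun ω p => h p.1 ω p.2) := rfl
  refine ⟨?_, ?_⟩
  · rw [heq]
    exact hlp.comp_aemeasurable (hcurry.comp_aemeasurable hpair)
  · rw [heq, ← AEMeasurable.map_map_of_aemeasurable hlp.aemeasurable
      (hcurry.comp_aemeasurable hpair),
      ← AEMeasurable.map_map_of_aemeasurable hcurry.aemeasurable hpair, hlaw,
      pi_map_curry fun _ _ : Fin M => complexGaussian]
    have : SigmaFinite ((Measure.pi fun _ : Fin M => complexGaussian).map (WithLp.toLp 2)) := by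
      rw [← gaussianVec]; infer_instance
    exact Measure.pi_map_pi (μ := fun _ : Fin M => Measure.pi fun _ : Fin M => complexGaussian)
      (f := fun _ => WithLp.toLp 2) fun _ => by fun_prop

lemma IsModel.hasLaw_codebooks [IsProbabilityMeasure μ] (hm : IsModel μ h w F) :
    HasLaw (fun ω i k => w i k ω) (Measure.pi fun i => Measure.pi fun k => μ.map (w i k)) μ := by
  have hmeas : ∀ p : Fin M × Fin (2 ^ B), AEMeasurable (w p.1 p.2) μ := fun p =>
    hm.codebook_aemeasurable p.1 p.2
  have hlaw := (iIndepFun_iff_map_fun_eq_pi_map hmeas).1 hm.codebook_indep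
  have hcurry : Measurable fun (x : Fin M × Fin (2 ^ B) → CVec M) i k => x (i, k) := by fun_prop
  have hpair : AEMeasurable (fun ω (p : Fin M × Fin (2 ^ B)) => w p.1 p.2 ω) μ :=
    aemeasurable_pi_lambda _ hmeas
  have := fun i k => (hm.codebook_law i k).prob
  refine ⟨hcurry.comp_aemeasurable hpair, ?_⟩
  rw [← pi_map_curry fun i k => μ.map (w i k), ← hlaw,
    AEMeasurable.map_map_of_aemeasurable hcurry.aemeasurable hpair]
  rfl

/-- The channels and codebooks of the users are independent, each with law `userLaw`. -/
lemma IsModel.hasLaw_users [IsProbabilityMeasure μ] (hm : IsModel μ h w F) :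
    HasLaw (fun ω i => (h i ω, fun k => w i k ω))
      (Measure.pi fun i => userLaw fun k => μ.map (w i k)) μ := by
  have hH := hm.hasLaw_channels
  have hW := hm.hasLaw_codebooks
  have := fun i k => (hm.codebook_law i k).prob
  have hprod := hm.channel_codebook_indep.map_prod_eq_prod_map_map hH.aemeasurable hW.aemeasurable
  rw [hH.map_eq, hW.map_eq] at hprod
  have hmp := (measurePreserving_arrowProdEquivProdArrow (CVec M) (Fin (2 ^ B) → CVec M) (Fin M)
    (fun _ => gaussianVec M) (fun i => Measure.pi fun k => μ.map (w i k))).symm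
  refine ⟨?_, ?_⟩
  · exact hmp.measurable.comp_aemeasurable (hH.aemeasurable.prodMk hW.aemeasurable)
  · have := hmp.map_eq
    rw [← hprod, AEMeasurable.map_map_of_aemeasurable hmp.measurable.aemeasurable
      (hH.aemeasurable.prodMk hW.aemeasurable)] at this
    exact this

/-- Almost surely the fed back index is the first maximizer, as there are no ties. -/
lemma IsModel.ae_feedback_eq [IsProbabilityMeasure μ] (hM : 2 ≤ M) (hm : IsModel μ h w F) :
    ∀ᵐ ω ∂μ, ∀ i, w i (F i ω) ω = quantized (h i ω, fun k => w i k ω) := by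
  have hlaw := hm.hasLaw_users
  have hp := fun i => isProbabilityMeasure_userLaw (hm.codebook_law i)
  have hties : ∀ᵐ ω ∂μ, ∀ i, ∀ k l, k ≠ l →
      ‖inner ℂ (h i ω) (w i k ω)‖ ≠ ‖inner ℂ (h i ω) (w i l ω)‖ := by
    have h1 : ∀ᵐ x ∂Measure.pi fun i => userLaw fun k => μ.map (w i k), ∀ i, ∀ k l, k ≠ l →
        ‖inner ℂ (x i).1 ((x i).2 k)‖ ≠ ‖inner ℂ (x i).1 ((x i).2 l)‖ := by
      rw [ae_all_iff]
      intro i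
      exact (Measure.quasiMeasurePreserving_eval (fun i => userLaw fun k => μ.map (w i k)) i).ae
        (ae_userLaw_injective hM (hm.codebook_law i))
    rw [← hlaw.map_eq] at h1
    exact ae_of_ae_map hlaw.aemeasurable h1
  filter_upwards [hties, ae_all_iff.2 hm.index_argmax] with ω h1 h2 i
  -- Two distinct maximizers would tie.
  have h3 : F i ω = bestIndex (h i ω, fun k => w i k ω) := by
    by_contra hne
    exact h1 i _ _ hne (le_antisymm
      (isBest_bestIndex (h i ω, fun k => w i k ω) (F i ω)) (h2 i _))
  rw [h3]
  rfl

lemma measurable_sinr (P : ℝ) (i : Fin M) :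
    Measurable fun p : (Fin M → CVec M) × (Fin M → CVec M) => sinr P p.1 p.2 i := by
  unfold sinr
  fun_prop

lemma sinr_nonneg {P : ℝ} (hP : 0 ≤ P) (h v : Fin M → CVec M) (i : Fin M) :
    0 ≤ sinr P h v i := by
  unfold sinr
  positivity

lemma measurable_log_one_add_sinr {K : Type*} [Fintype K] [LinearOrder K] [Nonempty K] (P : ℝ)
    (i : Fin M) :
    Measurable fun x : Fin M → CVec M × (K → CVec M) => Real.log
      (1 + sinr P (fun k => (x k).1) (zfVector fun k => quantized (x k)) i) := by
  have hq := measurable_quantized (M := M) (K := K)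
  have hqq : Measurable fun (x : Fin M → CVec M × (K → CVec M)) k => quantized (x k) :=
    measurable_pi_lambda _ fun k => hq.comp (measurable_pi_apply k)
  have hz : Measurable fun y : Fin M → CVec M => zfVector y :=
    measurable_pi_lambda _ fun j => measurable_zfVector j
  have hh : Measurable fun (x : Fin M → CVec M × (K → CVec M)) k => (x k).1 :=
    measurable_pi_lambda _ fun k => (measurable_pi_apply k).fst
  have hpair := hh.prodMk (hz.comp hqq)
  have hs := (measurable_sinr P i).comp hpair
  exact Real.measurable_log.comp (hs.const_add 1)

/-- The bound, in nats, for the rate of a user. -/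
def rateBound (M B : ℕ) : ℝ :=
  Real.log 2 + (B * Real.log 2 + 1) / (M - 1) + betaBound M

/-- Integrates the pointwise bound for an arbitrary interferer `j ≠ i`, which exists because `M ≥
2`. -/
lemma lintegral_log_one_add_sinr_le {K : Type*} [Fintype K] [LinearOrder K] [Nonempty K]
    (hM : 2 ≤ M) (hK : Fintype.card K = 2 ^ B) {ν : Fin M → K → Measure (CVec M)}
    (hν : ∀ i k, IsIsotropicOnSphere (ν i k)) {P : ℝ} (hP : 0 < P) (i : Fin M) :
    ∫⁻ x, ENNReal.ofReal (Real.log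
        (1 + sinr P (fun k => (x k).1) (zfVector fun k => quantized (x k)) i))
        ∂Measure.pi (fun i => userLaw (ν i)) ≤ ENNReal.ofReal (rateBound M B) := by
  have hp := fun i => isProbabilityMeasure_userLaw (hν i)
  have : Nontrivial (Fin M) := Fin.nontrivial_iff_two_le.2 hM
  obtain ⟨j, hij⟩ := exists_ne i
  have hq := measurable_quantized (M := M) (K := K)
  have hM' : (2 : ℝ) ≤ M := by exact_mod_cast hM
  have hZ : Measurable fun d : CVec M × (K → CVec M) =>
      negLog (1 - ‖inner ℂ d.1 (quantized d)‖ ^ 2 / ‖d.1‖ ^ 2) :=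
    measurable_negLog.comp (by fun_prop)
  have hZi : Measurable fun x : Fin M → CVec M × (K → CVec M) =>
      negLog (1 - ‖inner ℂ (x i).1 (quantized (x i))‖ ^ 2 / ‖(x i).1‖ ^ 2) :=
    hZ.comp (measurable_pi_apply i)
  have h1 : ∀ᵐ x ∂Measure.pi (fun i => userLaw (ν i)), ‖quantized (x i)‖ = 1 := by
    filter_upwards [(Measure.quasiMeasurePreserving_eval (fun i => userLaw (ν i)) i).ae
      (ae_userLaw_norm_eq_one (hν i))] with x hx
    exact hx _
  have hquant : ∫⁻ x, negLog (1 - ‖inner ℂ (x i).1 (quantized (x i))‖ ^ 2 / ‖(x i).1‖ ^ 2)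
      ∂Measure.pi (fun i => userLaw (ν i)) ≤ ENNReal.ofReal ((B * Real.log 2 + 1) / (M - 1)) := by
    have h2 := (measurePreserving_eval (fun i => userLaw (ν i)) i).lintegral_comp hZ
    have h3 := lintegral_negLog_quantized_le hM (hν i)
    rw [hK] at h3
    push_cast [Real.log_pow] at h3
    exact (le_of_eq h2).trans h3
  have hB : 0 ≤ (B * Real.log 2 + 1) / ((M : ℝ) - 1) :=
    div_nonneg (by positivity) (by linarith)
  calc _ ≤ ∫⁻ x, (ENNReal.ofReal (Real.log 2)
        + (negLog (1 - ‖inner ℂ (x i).1 (quantized (x i))‖ ^ 2 / ‖(x i).1‖ ^ 2)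
        + interferenceLoss (x i).1 (quantized (x i)) (zfVector (fun k => quantized (x k)) j)))
        ∂Measure.pi (fun i => userLaw (ν i)) := by
        refine lintegral_mono_ae ?_
        filter_upwards [h1] with x hx
        exact ofReal_log_one_add_sinr_le hP (fun k => (x k).1) (fun k => quantized (x k))
          hij.symm hx
    _ = ENNReal.ofReal (Real.log 2)
        + (∫⁻ x, negLog (1 - ‖inner ℂ (x i).1 (quantized (x i))‖ ^ 2 / ‖(x i).1‖ ^ 2)
          ∂Measure.pi (fun i => userLaw (ν i))
        + ∫⁻ x, interferenceLoss (x i).1 (quantized (x i))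
          (zfVector (fun k => quantized (x k)) j) ∂Measure.pi (fun i => userLaw (ν i))) := by
        rw [lintegral_add_left measurable_const, lintegral_add_left hZi]
        simp
    _ ≤ ENNReal.ofReal (Real.log 2) + (ENNReal.ofReal ((B * Real.log 2 + 1) / (M - 1))
        + ENNReal.ofReal (betaBound M)) :=
        add_le_add le_rfl (add_le_add hquant (lintegral_pi_interferenceLoss_le hM hν hij.symm))
    _ = ENNReal.ofReal (rateBound M B) := by
        rw [← ENNReal.ofReal_add hB (betaBound_nonneg hM),
          ← ENNReal.ofReal_add (Real.log_nonneg one_le_two)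
            (add_nonneg hB (betaBound_nonneg hM)), rateBound, add_assoc]

lemma instRate_nonneg {M B : ℕ} {Ω : Type*} {h : Fin M → Ω → CVec M}
    {w : Fin M → Fin (2 ^ B) → Ω → CVec M} {F : Fin M → Ω → Fin (2 ^ B)} {P : ℝ} (hP : 0 ≤ P) (i : Fin M) (ω : Ω) : 0 ≤ instRate h w F P i ω :=
  Real.logb_nonneg one_lt_two (le_add_of_nonneg_right (sinr_nonneg hP _ _ i))

/-- The model does not require `F` to be measurable; the rate is almost surely equal to one built
from the measurable map `quantized`. -/
lemma IsModel.aestronglyMeasurable_instRate [IsProbabilityMeasure μ] (hM : 2 ≤ M)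
    (hm : IsModel μ h w F) (P : ℝ) (i : Fin M) :
    AEStronglyMeasurable (instRate h w F P i) μ := by
  have h1 : AEMeasurable (fun ω => Real.log (1 + sinr P (fun k => h k ω)
      (zfVector fun j => quantized (h j ω, fun k => w j k ω)) i) / Real.log 2) μ :=
    ((measurable_log_one_add_sinr P i).comp_aemeasurable hm.hasLaw_users.aemeasurable).div_const _
  refine h1.aestronglyMeasurable.congr ?_
  filter_upwards [hm.ae_feedback_eq hM] with ω hω
  simp only [instRate, hω, Real.logb]

lemma IsModel.lintegral_instRate_le [IsProbabilityMeasure μ] (hM : 2 ≤ M) (hm : IsModel μ h w F)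
    {P : ℝ} (hP : 0 < P) (i : Fin M) :
    ∫⁻ ω, ENNReal.ofReal (instRate h w F P i ω) ∂μ
      ≤ ENNReal.ofReal (rateBound M B / Real.log 2) := by
  have hlaw := hm.hasLaw_users
  have hl2 : 0 < Real.log 2 := Real.log_pos one_lt_two
  have h1 := lintegral_log_one_add_sinr_le (B := B) hM (by simp) hm.codebook_law hP i
  rw [← hlaw.map_eq, lintegral_map' (measurable_log_one_add_sinr P i).ennreal_ofReal.aemeasurable
    hlaw.aemeasurable] at h1
  have h2 : ∀ᵐ ω ∂μ, ENNReal.ofReal (instRate h w F P i ω)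
      = ENNReal.ofReal (Real.log (1 + sinr P (fun k => h k ω)
        (zfVector fun j => quantized (h j ω, fun k => w j k ω)) i))
        * ENNReal.ofReal (Real.log 2)⁻¹ := by
    filter_upwards [hm.ae_feedback_eq hM] with ω hω
    rw [← ENNReal.ofReal_mul' (by positivity)]
    simp only [instRate, hω, Real.logb, div_eq_mul_inv]
  rw [lintegral_congr_ae h2, lintegral_mul_const' _ _ ENNReal.ofReal_ne_top, div_eq_mul_inv,
    ENNReal.ofReal_mul' (by positivity)]
  exact mul_le_mul_left h1 _

lemma IsModel.integrable_instRate [IsProbabilityMeasure μ] (hM : 2 ≤ M) (hm : IsModel μ h w F)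
    {P : ℝ} (hP : 0 < P) (i : Fin M) : Integrable (instRate h w F P i) μ :=
  (lintegral_ofReal_ne_top_iff_integrable (hm.aestronglyMeasurable_instRate hM P i)
    (Filter.Eventually.of_forall (instRate_nonneg hP.le i))).1
    ((hm.lintegral_instRate_le hM hP i).trans_lt ENNReal.ofReal_lt_top).ne

lemma IsModel.userRate_le [IsProbabilityMeasure μ] (hM : 2 ≤ M) (hm : IsModel μ h w F)
    {P : ℝ} (hP : 0 < P) (i : Fin M) :
    userRate μ h w F P i
      ≤ 1 + (B + Real.logb 2 (Real.exp 1)) / (M - 1) + betaBound M / Real.log 2 := by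
  have hl2 : 0 < Real.log 2 := Real.log_pos one_lt_two
  have hM' : (2 : ℝ) ≤ M := by exact_mod_cast hM
  have hpos : 0 ≤ rateBound M B / Real.log 2 := by
    have h1 := betaBound_nonneg hM
    have h2 : 0 ≤ (B * Real.log 2 + 1) / ((M : ℝ) - 1) :=
      div_nonneg (by positivity) (by linarith)
    unfold rateBound
    positivity
  have hle : userRate μ h w F P i ≤ rateBound M B / Real.log 2 := by
    rw [userRate, integral_eq_lintegral_of_nonneg_ae
      (Filter.Eventually.of_forall (instRate_nonneg hP.le i))
      (hm.aestronglyMeasurable_instRate hM P i)]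
    exact ENNReal.toReal_le_of_le_ofReal hpos (hm.lintegral_instRate_le hM hP i)
  refine hle.trans_eq ?_
  have : (M : ℝ) - 1 ≠ 0 := by linarith
  -- Conversion from nats to bits: `log₂ e = 1 / log 2`.
  rw [rateBound, Real.logb, Real.log_exp]
  field_simp

lemma IsModel.throughputFB_le [IsProbabilityMeasure μ] (hM : 2 ≤ M) (hm : IsModel μ h w F)
    {P : ℝ} (hP : 0 < P) :
    throughputFB μ h w F P
      ≤ M * (1 + (B + Real.logb 2 (Real.exp 1)) / (M - 1) + betaBound M / Real.log 2) := by
  refine (Finset.sum_le_sum fun i _ => hm.userRate_le hM hP i).trans_eq ?_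
  rw [Finset.sum_const, Finset.card_univ, Fintype.card_fin, nsmul_eq_mul]

lemma betaBound_div_log_two (hM : 3 ≤ M) :
    betaBound M / Real.log 2 = Real.logb 2 (Real.exp 1) + Real.logb 2 (M - 2) := by
  rw [betaBound, if_neg (by omega), Real.logb, Real.logb, Real.log_exp, add_div]

end Model

end

end FiniteRateFeedback

open FiniteRateFeedback in
theorem theorem2 (M B : ℕ) (hM : 2 ≤ M) {Ω : Type*} [MeasurableSpace Ω]
    (μ : Measure Ω) [IsProbabilityMeasure μ]
    (h : Fin M → Ω → CVec M) (w : Fin M → Fin (2 ^ B) → Ω → CVec M)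
    (F : Fin M → Ω → Fin (2 ^ B)) (hmodel : IsModel μ h w F) :
    -- the average rates are genuine (finite) expectations
    (∀ P : ℝ, 0 < P → ∀ i, Integrable (instRate h w F P i) μ) ∧
    -- the throughput is bounded in the SNR
    BddAbove (throughputFB μ h w F '' Set.Ioi 0) ∧
    -- the explicit bound, for the sum of the rates and for `M` times the rate of any one user
    (3 ≤ M → ∀ P : ℝ, 0 < P →
      throughputFB μ h w F P ≤ M * (1 + (B + Real.logb 2 (Real.exp 1)) / (M - 1)
        + Real.logb 2 (Real.exp 1) + Real.logb 2 (M - 2)) ∧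
      ∀ i, M * userRate μ h w F P i ≤ M * (1 + (B + Real.logb 2 (Real.exp 1)) / (M - 1)
        + Real.logb 2 (Real.exp 1) + Real.logb 2 (M - 2))) ∧
    -- for two antennas the last two terms are absent
    (M = 2 → ∀ P : ℝ, 0 < P →
      throughputFB μ h w F P ≤ M * (1 + (B + Real.logb 2 (Real.exp 1)) / (M - 1)) ∧
      ∀ i, M * userRate μ h w F P i ≤
        M * (1 + (B + Real.logb 2 (Real.exp 1)) / (M - 1))) := by
  refine ⟨fun P hP i => hmodel.integrable_instRate hM hP i, ?_, fun h3 P hP => ?_,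
    fun h2 P hP => ?_⟩
  · refine ⟨M * (1 + (B + Real.logb 2 (Real.exp 1)) / (M - 1) + betaBound M / Real.log 2), ?_⟩
    rintro _ ⟨P, hP, rfl⟩
    exact hmodel.throughputFB_le hM hP
  · rw [add_assoc _ (Real.logb 2 (Real.exp 1)) (Real.logb 2 (M - 2)), ← betaBound_div_log_two h3]
    exact ⟨hmodel.throughputFB_le hM hP, fun i =>
      mul_le_mul_of_nonneg_left (hmodel.userRate_le hM hP i) (Nat.cast_nonneg M)⟩
  · have h0 : betaBound M / Real.log 2 = 0 := by simp [betaBound, h2]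
    have h1 := hmodel.throughputFB_le hM hP
    have h3 := fun i => hmodel.userRate_le hM hP i
    simp only [h0, add_zero] at h1 h3
    exact ⟨h1, fun i => mul_le_mul_of_nonneg_left (h3 i) (Nat.cast_nonneg M)⟩
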